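/- A \emph{parking function} of size $n$ is a Dyck path from $(0,0)$ to $(n,n)$ (with $n$ north-steps and $n$ east-steps, never going below the line $y=x$) whose north-steps are labelled bijectively by $1,\dots,n$ so that any two consecutive north-steps (with no east-step between them) have increasing labels. Let $\phi(p)\in\mathcal S_n$ be the permutation obtained by reading the labels of the north-steps of $p$ in order, and let $\mathrm{pf}_n(\rho_1,\dots,\rho_m)$ be the number of parking functions $p$ of size $n$ such that $\phi(p)$ avoids each of the permutation patterns $\rho_1,\dots,\rho_m$. Then for every $n\ge 0$ $$\mathrm{pf}_n(231,312,321)=\sum_{k=0}^{\lfloor n/2\rfloor}\frac{1}{n+1}\binom{2n-k}{n+k}\binom{n+k}{k}.$$ For every $n\ge 1$ this is also the number of dissections of a convex $(n+2)$-gon (with labelled vertices) into triangles and quadrilaterals by pairwise non-crossing diagonals. Moreover, for every $n\ge 1$ there is a bijection between the parking functions $p$ of size $n$ for which $\phi(p)$ avoids $231$, $312$ and $321$ and these dissections, under which the number of quadrilaterals of the dissection equals the number of consecutive $21$ patterns of $\phi(p)$, that is, of indices $i$ with $1\le i<n$ and $\phi(p)_i>\phi(p)_{i+1}$. -/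

import Mathlib

namespace PatternParking

/-- A labelled Dyck path of size `n`: a Dyck path with `n` north-steps (`U`) and `n` east-steps
(`D`), together with the permutation whose `i`-th entry is the label of the `i`-th north-step,
such that any two consecutive north-steps carry increasing labels. Positions and labels are
indexed from `0`. -/
structure ParkingFunction (n : ℕ) where
  path : DyckWord
  semilength_path : path.semilength = n
  /-- the permutation obtained by reading the labels of the north-steps in order -/
  perm : Equiv.Perm (Fin n)
  increasing : ∀ (l₁ l₂ : List DyckStep) (i j : Fin n),
    path.toList = l₁ ++ DyckStep.U :: DyckStep.U :: l₂ →
    (i : ℕ) = l₁.count DyckStep.U → (j : ℕ) = l₁.count DyckStep.U + 1 → perm i < perm j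

/-- `π` contains the pattern `ρ`. -/
def Contains {n m : ℕ} (π : Equiv.Perm (Fin n)) (ρ : Equiv.Perm (Fin m)) : Prop :=
  ∃ f : Fin m → Fin n, StrictMono f ∧ ∀ a b : Fin m, π (f a) ≤ π (f b) ↔ ρ a ≤ ρ b

/-- The parking functions of size `n` whose permutation avoids every pattern in `P`. -/
def AvoidingParkingFunction (n : ℕ) (P : Set ((m : ℕ) × Equiv.Perm (Fin m))) : Type :=
  {p : ParkingFunction n // ∀ ρ ∈ P, ¬ Contains p.perm ρ.2}

/-- The number of parking functions of size `n` avoiding every pattern in `P`. -/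
noncomputable def pf (n : ℕ) (P : Set ((m : ℕ) × Equiv.Perm (Fin m))) : ℕ :=
  Nat.card (AvoidingParkingFunction n P)

/-- The permutation `231`, in one-line notation with entries shifted to `0, 1, 2`. -/
def p231 : Equiv.Perm (Fin 3) := ⟨![1, 2, 0], ![2, 0, 1], by decide, by decide⟩

/-- The permutation `312`, in one-line notation with entries shifted to `0, 1, 2`. -/
def p312 : Equiv.Perm (Fin 3) := ⟨![2, 0, 1], ![1, 2, 0], by decide, by decide⟩

/-- The permutation `321`, in one-line notation with entries shifted to `0, 1, 2`. -/
def p321 : Equiv.Perm (Fin 3) := ⟨![2, 1, 0], ![2, 1, 0], by decide, by decide⟩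

/-- The set of patterns `{231, 312, 321}`. -/
def patterns : Set ((m : ℕ) × Equiv.Perm (Fin m)) := {⟨3, p231⟩, ⟨3, p312⟩, ⟨3, p321⟩}

/-- The number of consecutive `21` patterns (descents) of a permutation. -/
noncomputable def descents {n : ℕ} (π : Equiv.Perm (Fin n)) : ℕ :=
  Set.ncard {i : Fin n | ∃ j : Fin n, (j : ℕ) = i + 1 ∧ π j < π i}

/-- For `a < b`: the chord from `a` to `b` is a side of the convex polygon with vertices
`0, 1, …, N - 1` in cyclic order. -/
def IsSide {N : ℕ} (a b : Fin N) : Prop :=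
  (a : ℕ) + 1 = b ∨ ((a : ℕ) = 0 ∧ (b : ℕ) + 1 = N)

/-- A dissection of the convex polygon with labelled vertices `0, 1, …, N - 1` (in cyclic order):
a set of pairwise non-crossing diagonals. The diagonal joining `a < b` is stored as `(a, b)`. -/
structure Dissection (N : ℕ) where
  diagonals : Finset (Fin N × Fin N)
  isDiagonal : ∀ d ∈ diagonals, d.1 < d.2 ∧ ¬ IsSide d.1 d.2
  noncrossing : ∀ d ∈ diagonals, ∀ e ∈ diagonals, ¬ (d.1 < e.1 ∧ e.1 < d.2 ∧ d.2 < e.2)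

/-- For `a < b` in `S`: `a` and `b` are neighbours in the cyclic order restricted to `S`. -/
def Neighbours {N : ℕ} (S : Finset (Fin N)) (a b : Fin N) : Prop :=
  (∀ c ∈ S, ¬ (a < c ∧ c < b)) ∨ (∀ c ∈ S, ¬ (c < a ∨ b < c))

/-- `S` is the vertex set of one of the polygonal regions cut out by the dissection `D`: each edge
of the polygon spanned by `S` is a side or a chosen diagonal, and no chosen diagonal is a diagonal
of the polygon spanned by `S`. -/
def Dissection.IsRegion {N : ℕ} (D : Dissection N) (S : Finset (Fin N)) : Prop :=
  3 ≤ S.card ∧ ∀ a ∈ S, ∀ b ∈ S, a < b →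
    (Neighbours S a b ↔ (IsSide a b ∨ (a, b) ∈ D.diagonals))

/-- The dissections of a convex `N`-gon into triangles and quadrilaterals. -/
def TriQuadDissection (N : ℕ) : Type :=
  {D : Dissection N // ∀ S : Finset (Fin N), D.IsRegion S → S.card = 3 ∨ S.card = 4}

/-- The number of quadrilaterals of a dissection. -/
noncomputable def Dissection.quadrilaterals {N : ℕ} (D : Dissection N) : ℕ :=
  Set.ncard {S : Finset (Fin N) | D.IsRegion S ∧ S.card = 4}

end PatternParking

/-! The patterns 231, 312 and 321 are exactly the permutations of three letters whose last entry is
smaller than the first, so avoiding them means that no two entries at distance at least two are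
inverted (`avoids_iff`). Such a permutation is a product of disjoint adjacent transpositions,
determined by its descent set, in which no two positions are consecutive (`eq_of_descentSet_eq`,
`descentSet_layeredPerm`). The labelling condition then says only that the north-step at a descent
is not directly followed by a north-step. Parking functions with `k` descents thus become Dyck paths
with `k` marked north-steps, each followed by an east-step, where successive north-steps are never
both marked and the last one is unmarked.

Prefixes of such paths satisfy a last-step recurrence, solved by ballot-type differences of
binomials (`ncard_runs`). At height zero the count, times `n + 1`, is `(n - k).choose k * (2 * n -
k).choose n`.

On the other side, a dissection rooted at the side `(0, n + 1)` is dual to a plane tree with `n + 1`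
leaves, where triangles are binary and quadrilaterals ternary vertices. The region resting on a
given chord exists and is unique (`EdgeSystem.exists_cell`, `EdgeSystem.cell_unique`), so cutting
along regions gives a bijection. The trees are counted through plane forests
(`BTTree.ncard_forests_mul`).

The two counts agree for every `k` (`ncard_treesWith_eq_ncard_runs`). Summing over `k` gives the
formula, and choosing a bijection on each fibre gives the statistic-preserving bijection, which is
therefore not explicit. -/

namespace PatternParking

/-! ### Marked Dyck prefixes and their recurrence -/

/-- Prefixes of marked Dyck paths, the last step being the head of the list: `none` is an
east-step, `some b` a north-step, marked if `b`. A marked north-step is followed by an east-step,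
and the next north-step is unmarked. `Run b n k h w` says that `w` has `n` north-steps, `k` of them
marked, ends at height `h`, and that its last north-step is marked iff `b`. -/
inductive Run : Bool → ℕ → ℕ → ℕ → List (Option Bool) → Prop
  | nil : Run false 0 0 0 []
  | down {b n k h w} : Run b n k (h + 1) w → Run b n k h (none :: w)
  | up {n k h w} : Run false n k h w → Run false (n + 1) k (h + 1) (some false :: w)
  | up_down {n k h w} : Run true n k h (none :: w) →
      Run false (n + 1) k (h + 1) (some false :: none :: w)
  | mark {n k h w} : Run false n k h w → Run true (n + 1) (k + 1) (h + 1) (some true :: w)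

/-- The words counted by `Run`. -/
def runs (b : Bool) (n k h : ℕ) : Set (List (Option Bool)) := {w | Run b n k h w}

theorem Run.height_le {b n k h w} (r : Run b n k h w) : h ≤ n := by
  induction r <;> omega

theorem Run.marks_le {b n k h w} (r : Run b n k h w) : k + (if b then 0 else min n 1) ≤ n := by
  induction r with
  | nil => simp
  | down _ ih => exact ih
  | up _ ih => simp at ih ⊢; omega
  | up_down _ ih => simp at ih ⊢; omega
  | mark _ ih => simp at ih ⊢; omega

theorem runs_eq_empty_of_lt_height {b n k h} (hn : n < h) : runs b n k h = ∅ :=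
  Set.eq_empty_of_forall_notMem fun _ r => absurd (Run.height_le r) (by omega)

theorem runs_true_zero (n h : ℕ) : runs true n 0 h = ∅ := by
  refine Set.eq_empty_of_forall_notMem fun w r => ?_
  have : ∀ b n k h w, Run b n k h w → b = true → k ≠ 0 := by
    intro b n k h w r
    induction r <;> simp_all
  exact this _ _ _ _ _ r rfl rfl

theorem runs_false_self (k h : ℕ) : runs false (k + 1) (k + 1) h = ∅ := by
  refine Set.eq_empty_of_forall_notMem fun w r => ?_
  have := Run.marks_le r
  simp at this

theorem runs_zero_zero_zero : runs false 0 0 0 = {[]} := by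
  ext w
  constructor
  · intro r
    cases r with
    | nil => rfl
    | down r => exact absurd r.height_le (by omega)
  · rintro rfl
    exact Run.nil

/-- A north-step ends at positive height, so a nonempty path at height zero ends in an east-step.
This is the boundary condition of the recurrence. -/
theorem runs_height_zero_false (n k : ℕ) :
    runs false (n + 1) k 0 = List.cons none '' runs false (n + 1) k 1 := by
  ext w
  constructor
  · intro r
    cases r with
    | down r => exact ⟨_, r, rfl⟩
  · rintro ⟨w, r, rfl⟩
    exact Run.down r

theorem runs_true_succ (n k h : ℕ) : runs true (n + 1) (k + 1) (h + 1) =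
    List.cons none '' runs true (n + 1) (k + 1) (h + 2) ∪
      List.cons (some true) '' runs false n k h := by
  ext w
  constructor
  · intro r
    cases r with
    | down r => exact Or.inl ⟨_, r, rfl⟩
    | mark r => exact Or.inr ⟨_, r, rfl⟩
  · rintro (⟨w, r, rfl⟩ | ⟨w, r, rfl⟩)
    · exact Run.down r
    · exact Run.mark r

/-- If the previous north-step is marked, an east-step separates it from the new one. Both letters
are stripped together, which leaves height `h + 1`. -/
theorem runs_false_succ (n k h : ℕ) : runs false (n + 1) k (h + 1) =
    List.cons none '' runs false (n + 1) k (h + 2) ∪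
      (List.cons (some false) '' runs false n k h ∪
        (fun w => some false :: none :: w) '' runs true n k (h + 1)) := by
  ext w
  constructor
  · intro r
    cases r with
    | down r => exact Or.inl ⟨_, r, rfl⟩
    | up r => exact Or.inr (Or.inl ⟨_, r, rfl⟩)
    | up_down r =>
      cases r with
      | down r => exact Or.inr (Or.inr ⟨_, r, rfl⟩)
  · rintro (⟨w, r, rfl⟩ | ⟨w, r, rfl⟩ | ⟨w, r, rfl⟩)
    · exact Run.down r
    · exact Run.up r
    · exact Run.up_down (Run.down r)

/-- Read off from the word alone, the flag separates the words built by `up` from those built by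
`up_down`, so that the union in `runs_false_succ` is disjoint. -/
theorem Run.last_mark_unique {b b' n n' k k' h h' w} (r : Run b n k h w)
    (r' : Run b' n' k' h' w) : b = b' := by
  induction r generalizing b' n' k' h' with
  | nil => cases r'; rfl
  | down _ ih => cases r' with | down r' => exact ih r'
  | up _ ih => cases r' <;> rfl
  | up_down _ ih => cases r' <;> rfl
  | mark _ ih => cases r'; rfl

theorem Run.length_eq {b n k h w} (r : Run b n k h w) : w.length + h = 2 * n := by
  induction r <;> simp_all <;> omega

theorem finite_runs (b : Bool) (n k h : ℕ) : (runs b n k h).Finite :=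
  (List.finite_length_le (Option Bool) (2 * n)).subset fun w r => by
    have := Run.length_eq r
    simp only [Set.mem_ofPred_eq]
    omega

theorem cons_injective {α : Type*} (a : α) : Function.Injective (List.cons a) :=
  fun _ _ h => (List.cons.inj h).2

theorem ncard_runs_height_zero_false (n k : ℕ) :
    (runs false (n + 1) k 0).ncard = (runs false (n + 1) k 1).ncard := by
  rw [runs_height_zero_false, Set.ncard_image_of_injective _ (cons_injective _)]

theorem ncard_runs_true_succ (n k h : ℕ) : (runs true (n + 1) (k + 1) (h + 1)).ncard =
    (runs true (n + 1) (k + 1) (h + 2)).ncard + (runs false n k h).ncard := by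
  rw [runs_true_succ, Set.ncard_union_eq _ ((finite_runs _ _ _ _).image _)
    ((finite_runs _ _ _ _).image _), Set.ncard_image_of_injective _ (cons_injective _),
    Set.ncard_image_of_injective _ (cons_injective _)]
  rw [Set.disjoint_left]
  rintro _ ⟨w, -, rfl⟩ ⟨w', -, h'⟩
  simp at h'

theorem ncard_runs_false_succ (n k h : ℕ) : (runs false (n + 1) k (h + 1)).ncard =
    (runs false (n + 1) k (h + 2)).ncard +
      ((runs false n k h).ncard + (runs true n k (h + 1)).ncard) := by
  have hinj : Function.Injective fun w : List (Option Bool) => some false :: none :: w :=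
    (cons_injective (some false)).comp (cons_injective none)
  rw [runs_false_succ, Set.ncard_union_eq _ ((finite_runs _ _ _ _).image _)
    (((finite_runs _ _ _ _).image _).union ((finite_runs _ _ _ _).image _)),
    Set.ncard_union_eq _ ((finite_runs _ _ _ _).image _) ((finite_runs _ _ _ _).image _),
    Set.ncard_image_of_injective _ (cons_injective _),
    Set.ncard_image_of_injective _ (cons_injective _), Set.ncard_image_of_injective _ hinj]
  · rw [Set.disjoint_left]
    rintro _ ⟨w, r, rfl⟩ ⟨w', r', h'⟩
    obtain rfl := (List.cons.inj h').2
    exact Bool.false_ne_true (Run.last_mark_unique r (Run.down (b := true) r'))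
  · rw [Set.disjoint_left]
    rintro _ ⟨w, -, rfl⟩ (⟨w', -, h'⟩ | ⟨w', -, h'⟩) <;> simp at h'

/-! ### Closed formulas for the number of marked prefixes -/

/-- `choosePred j k` is `(j - 1).choose (k - 1)`, and `0` if `j = 0` or `k = 0`. -/
def choosePred : ℕ → ℕ → ℕ
  | j + 1, k + 1 => j.choose k
  | _, _ => 0

theorem choosePred_zero_right (j : ℕ) : choosePred j 0 = 0 := by cases j <;> rfl

/-- The number of marked prefixes with `j + k` north-steps, `k` of them marked and followed by
another north-step, that end at height `h`. -/
def closedRuns (j k h : ℕ) : ℤ :=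
  j.choose k * (2 * j + k - h).choose (j + k) -
    (j.choose k + choosePred j k) * (2 * j + k - h).choose (j + k + 1)

/-- The number of marked prefixes with `j + k + 1` north-steps, `k + 1` of them marked, among them
the last one, that end at height `h + 1`. -/
def openRuns (j k h : ℕ) : ℤ :=
  j.choose k * (2 * j + k + 1 - h).choose (j + k + 1) -
    (j.choose k + choosePred j k) * (2 * j + k + 1 - h).choose (j + k + 2)

/-- Pascal's rule in the upper index, matching `ncard_runs_true_succ`; the next two lemmas match
`ncard_runs_false_succ` in the same way. -/
theorem openRuns_sub (j k h : ℕ) (hh : h ≤ j + k) :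
    openRuns j k h - openRuns j k (h + 1) = closedRuns j k h := by
  obtain ⟨m, hm⟩ : ∃ m, 2 * j + k - h = m := ⟨_, rfl⟩
  have h1 : 2 * j + k + 1 - h = m + 1 := by omega
  have h2 : 2 * j + k + 1 - (h + 1) = m := by omega
  simp only [openRuns, closedRuns, hm, h1, h2, Nat.choose_succ_succ m]
  push_cast
  ring

theorem closedRuns_sub_zero (j h : ℕ) (hh : h ≤ j) :
    closedRuns (j + 1) 0 (h + 1) - closedRuns (j + 1) 0 (h + 2) = closedRuns j 0 h := by
  obtain ⟨m, hm⟩ : ∃ m, 2 * j - h = m := ⟨_, rfl⟩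
  have h1 : 2 * (j + 1) - (h + 1) = m + 1 := by omega
  have h2 : 2 * (j + 1) - (h + 2) = m := by omega
  simp only [closedRuns, h1, h2, hm, choosePred_zero_right, Nat.choose_zero_right, add_zero,
    Nat.choose_succ_succ m]
  push_cast
  ring

theorem closedRuns_sub_succ (j k h : ℕ) (hh : h ≤ j + k + 1) :
    closedRuns (j + 1) (k + 1) (h + 1) - closedRuns (j + 1) (k + 1) (h + 2) =
      closedRuns j (k + 1) h + openRuns j k h := by
  obtain ⟨m, hm⟩ : ∃ m, 2 * j + k + 1 - h = m := ⟨_, rfl⟩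
  have h1 : 2 * (j + 1) + (k + 1) - (h + 1) = m + 1 := by omega
  have h2 : 2 * (j + 1) + (k + 1) - (h + 2) = m := by omega
  have h3 : 2 * j + (k + 1) - h = m := by omega
  have e1 : j + 1 + (k + 1) = j + k + 1 + 1 := by ring
  have e2 : j + (k + 1) = j + k + 1 := by ring
  -- Pascal's rule for `choosePred` fails at `j = k = 0`. The factor in front repairs this, because
  -- it vanishes whenever `j = 0`.
  have key : (m.choose (j + k + 1 + 1) : ℤ) * (choosePred (j + 1) (k + 1) : ℤ) =
      m.choose (j + k + 1 + 1) * (choosePred j (k + 1) + choosePred j k : ℤ) := by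
    rcases j with _ | j
    · rw [Nat.choose_eq_zero_of_lt (by omega)]
      simp
    · rcases k with _ | k
      · simp [choosePred]
      · simp only [choosePred, Nat.choose_succ_succ j]
        push_cast
        ring
  simp only [closedRuns, openRuns, hm, h1, h2, h3, e1, e2, Nat.choose_succ_succ m,
    Nat.choose_succ_succ j]
  push_cast
  linear_combination -key

/-- For `j = k = 0` truncated subtraction would leave `Nat.choose 0 0 = 1`, so that case is
excluded. -/
theorem closedRuns_top (j k : ℕ) (h : ℕ) (hjk : 1 ≤ j + k) (hh : j + k < h) :
    closedRuns j k h = 0 := by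
  simp only [closedRuns]
  rw [Nat.choose_eq_zero_of_lt (show 2 * j + k - h < j + k by omega),
    Nat.choose_eq_zero_of_lt (show 2 * j + k - h < j + k + 1 by omega)]
  simp

theorem openRuns_top (j k : ℕ) (h : ℕ) (hh : j + k < h) :
    openRuns j k h = 0 := by
  simp only [openRuns]
  rw [Nat.choose_eq_zero_of_lt (show 2 * j + k + 1 - h < j + k + 1 by omega),
    Nat.choose_eq_zero_of_lt (show 2 * j + k + 1 - h < j + k + 2 by omega)]
  simp

theorem choosePred_mul (j k : ℕ) : j * choosePred j k = k * j.choose k := by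
  rcases j with _ | j
  · rcases k with _ | k <;> simp [choosePred]
  · rcases k with _ | k
    · simp [choosePred]
    · simp only [choosePred]
      rw [Nat.add_one_mul_choose_eq]
      ring

/-- Counterpart of `runs_height_zero_false`. This boundary condition is what dictates the
coefficient `j.choose k + choosePred j k`, which equals `(j + k) / j` times `j.choose k` when `j` is
positive. -/
theorem closedRuns_zero_eq_one (j k : ℕ) (hjk : 1 ≤ j + k) :
    closedRuns j k 0 = closedRuns j k 1 := by
  obtain ⟨n, hn⟩ : ∃ n, j + k = n + 1 := ⟨j + k - 1, by omega⟩
  rcases j with _ | j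
  · rcases k with _ | k
    · omega
    · simp [closedRuns, choosePred]
  have h1 : 2 * (j + 1) + k - 0 = (n + j + 1) + 1 := by omega
  have h2 : 2 * (j + 1) + k - 1 = n + j + 1 := by omega
  have h3 : ((n + j + 1).choose (n + 1) : ℤ) * (n + 1) = (n + j + 1).choose n * (j + 1) := by
    have := Nat.choose_succ_right_eq (n + j + 1) n
    rw [show n + j + 1 - n = j + 1 by omega] at this
    exact_mod_cast this
  have h4 : ((j : ℤ) + 1) * choosePred (j + 1) k = k * (j + 1).choose k := by
    exact_mod_cast choosePred_mul (j + 1) k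
  have hn' : (k : ℤ) = n - j := by
    have : ((j + 1 + k : ℕ) : ℤ) = ((n + 1 : ℕ) : ℤ) := by rw [hn]
    push_cast at this
    linarith
  simp only [closedRuns, h1, h2, hn, Nat.choose_succ_succ (n + j + 1)]
  push_cast
  have hj : ((j : ℤ) + 1) ≠ 0 := by positivity
  apply mul_left_cancel₀ hj
  rw [hn'] at h4
  linear_combination (-((n + j + 1).choose (n + 1) : ℤ)) * h4 - ((j + 1).choose k : ℤ) * h3

theorem ncard_runs (n : ℕ) :
    (∀ j k h, j + k = n → h ≤ n → ((runs false n k h).ncard : ℤ) = closedRuns j k h) ∧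
    (∀ j k h, j + k + 1 = n → h ≤ n → ((runs true n (k + 1) (h + 1)).ncard : ℤ) =
      openRuns j k h) := by
  induction n with
  | zero =>
    refine ⟨fun j k h hjk hh => ?_, fun j k h hjk _ => by omega⟩
    obtain ⟨rfl, rfl⟩ : j = 0 ∧ k = 0 := by omega
    obtain rfl : h = 0 := by omega
    rw [runs_zero_zero_zero]
    simp [closedRuns, choosePred]
  | succ n ih =>
    obtain ⟨ihf, iht⟩ := ih
    refine ⟨?_, ?_⟩
    · have pos : ∀ j k h, j + k = n + 1 → h ≤ n + 1 →
          ((runs false (n + 1) k (h + 1)).ncard : ℤ) = closedRuns j k (h + 1) := by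
        intro j k h hjk hh
        -- The recurrence expresses height `h + 1` through height `h + 2`, so the induction descends
        -- from heights exceeding the number of north-steps, where both sides vanish.
        induction hh using Nat.decreasingInduction with
        | self =>
          rw [runs_eq_empty_of_lt_height (by omega), closedRuns_top _ _ _ (by omega) (by omega)]
          simp
        | of_succ h hlt ih =>
          rcases j with _ | j
          · obtain rfl : k = n + 1 := by omega
            rw [runs_false_self]
            simp [closedRuns, choosePred]
          rw [ncard_runs_false_succ]
          push_cast
          rw [ih, ihf j k h (by omega) (by omega)]
          rcases k with _ | k
          · rw [runs_true_zero]
            simp only [Set.ncard_empty]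
            linear_combination -closedRuns_sub_zero j h (by omega)
          · rw [iht j k h (by omega) (by omega)]
            linear_combination -closedRuns_sub_succ j k h (by omega)
      intro j k h hjk hh
      rcases h with _ | h
      · rw [ncard_runs_height_zero_false, pos j k 0 hjk (by omega),
          closedRuns_zero_eq_one _ _ (by omega)]
      · exact pos j k h hjk (by omega)
    · intro j k h hjk hh
      induction hh using Nat.decreasingInduction with
      | self =>
        rw [runs_eq_empty_of_lt_height (by omega), openRuns_top _ _ _ (by omega)]
        simp
      | of_succ h hlt ih =>
        rw [ncard_runs_true_succ]
        push_cast
        rw [ih, ihf j k h (by omega) (by omega)]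
        linear_combination -openRuns_sub j k h (by omega)

theorem closedRuns_zero_mul (j k : ℕ) :
    ((j : ℤ) + k + 1) * closedRuns j k 0 = j.choose k * (2 * j + k).choose (j + k) := by
  have h3 : ((2 * j + k).choose (j + k + 1) : ℤ) * (j + k + 1) =
      (2 * j + k).choose (j + k) * j := by
    have := Nat.choose_succ_right_eq (2 * j + k) (j + k)
    rw [show 2 * j + k - (j + k) = j by omega] at this
    exact_mod_cast this
  have h4 : (j : ℤ) * choosePred j k = k * j.choose k := by
    exact_mod_cast choosePred_mul j k
  simp only [closedRuns, Nat.sub_zero]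
  linear_combination (-(j.choose k : ℤ) - choosePred j k) * h3
    - ((2 * j + k).choose (j + k) : ℤ) * h4

theorem ncard_runs_closed (j k : ℕ) :
    (j + k + 1) * (runs false (j + k) k 0).ncard = j.choose k * (2 * j + k).choose (j + k) := by
  have := closedRuns_zero_mul j k
  rw [← (ncard_runs (j + k)).1 j k 0 rfl (by omega)] at this
  exact_mod_cast this

/-! ### Marked words as paths with a set of marked indices -/

section Labels

open DyckStep

/-- The marked path obtained from the reversed path `w` by marking the north-steps whose index
lies in `M`. -/
def label (M : Finset ℕ) : List DyckStep → List (Option Bool)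
  | [] => []
  | D :: w => none :: label M w
  | U :: w => some (decide (w.count U ∈ M)) :: label M w

theorem label_congr {M M' : Finset ℕ} (w : List DyckStep)
    (h : ∀ i < w.count U, i ∈ M ↔ i ∈ M') : label M w = label M' w := by
  induction w with
  | nil => rfl
  | cons s w ih =>
    cases s with
    | D =>
      simp only [label]
      rw [ih fun i hi => h i (by simpa using hi)]
    | U =>
      simp only [label]
      rw [ih fun i hi => h i (by simp; omega), decide_eq_decide.2 (h (w.count U) (by simp))]

/-- The word records membership in `M` only for indices of actual north-steps, hence the bound on
`i`. -/
theorem label_injective {M M' : Finset ℕ} {w w' : List DyckStep} (h : label M w = label M' w') :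
    w = w' ∧ ∀ i < w.count U, i ∈ M ↔ i ∈ M' := by
  induction w generalizing w' with
  | nil =>
    rcases w' with _ | ⟨s, w'⟩
    · simp
    · cases s <;> simp [label] at h
  | cons s w ih =>
    rcases w' with _ | ⟨s', w'⟩
    · cases s <;> simp [label] at h
    · cases s <;> cases s' <;> simp only [label, List.cons.injEq, reduceCtorEq, false_and,
        Option.some.injEq, decide_eq_decide, true_and] at h
      · obtain ⟨h1, h2⟩ := h
        obtain ⟨rfl, h3⟩ := ih h2
        refine ⟨rfl, fun i hi => ?_⟩
        simp only [List.count_cons_self] at hi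
        rcases Nat.lt_succ_iff_lt_or_eq.1 hi with hi | rfl
        · exact h3 i hi
        · exact h1
      · obtain ⟨rfl, h3⟩ := ih h
        exact ⟨rfl, fun i hi => h3 i (by simpa using hi)⟩

/-- `w` is a reversed prefix of a Dyck path, and `M` is a set of indices of north-steps without
two consecutive elements, none of which is directly followed by a north-step. -/
structure Markable (w : List DyckStep) (M : Finset ℕ) : Prop where
  balanced : ∀ v, v <:+ w → v.count D ≤ v.count U
  lt_count : ∀ i ∈ M, i < w.count U
  sparse : ∀ i ∈ M, i + 1 ∉ M
  separated : ∀ l r, w = l ++ U :: U :: r → r.count U ∉ M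

theorem Markable.tail_down {w M} (m : Markable (D :: w) M) : Markable w M where
  balanced v hv := m.balanced v (hv.trans (List.suffix_cons _ _))
  lt_count i hi := by simpa using m.lt_count i hi
  sparse := m.sparse
  separated l r h := m.separated (D :: l) r (by simp [h])

theorem Markable.tail_up {w M} (m : Markable (U :: w) M) : Markable w (M.erase (w.count U)) where
  balanced v hv := m.balanced v (hv.trans (List.suffix_cons _ _))
  lt_count i hi := by
    have h1 := m.lt_count i (Finset.mem_of_mem_erase hi)
    have h2 := Finset.ne_of_mem_erase hi
    simp at h1
    omega
  sparse i hi h := m.sparse i (Finset.mem_of_mem_erase hi) (Finset.mem_of_mem_erase h)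
  separated l r h h' := m.separated (U :: l) r (by simp [h]) (Finset.mem_of_mem_erase h')

/-- The conditions on `M` are what the constructors of `Run` require: sparseness permits `mark`, and
separation forces the east-step of `up_down`. The converse is `Run.exists_markable`. -/
theorem Markable.run {w : List DyckStep} {M : Finset ℕ} (m : Markable w M) :
    Run (decide (∃ i ∈ M, i + 1 = w.count U)) (w.count U) M.card (w.count U - w.count D)
      (label M w) := by
  induction w generalizing M with
  | nil =>
    obtain rfl : M = ∅ := Finset.eq_empty_of_forall_notMem fun i hi => by
      simpa using m.lt_count i hi
    simpa [label] using Run.nil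
  | cons s w ih =>
    cases s with
    | D =>
      have h := ih m.tail_down
      have hb := m.balanced _ (List.suffix_refl _)
      simp only [List.count_cons_self, ne_eq, reduceCtorEq, not_false_eq_true,
        List.count_cons_of_ne] at hb ⊢
      have e : w.count U - w.count D = w.count U - (w.count D + 1) + 1 := by omega
      rw [e] at h
      exact Run.down h
    | U =>
      have h := ih m.tail_up
      have hb := m.balanced _ (List.suffix_cons _ _)
      have hl : label (M.erase (w.count U)) w = label M w :=
        label_congr w fun i hi => by simp [hi.ne]
      rw [hl] at h
      have hlast : (∃ i ∈ M, i + 1 = (U :: w).count U) ↔ w.count U ∈ M := by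
        simp
      have e : (U :: w).count U - (U :: w).count D = w.count U - w.count D + 1 := by
        simp; omega
      rw [decide_eq_decide.2 hlast, e, List.count_cons_self]
      simp only [label]
      by_cases hM : w.count U ∈ M
      · have hf : ¬ ∃ i ∈ M.erase (w.count U), i + 1 = w.count U := by
          rintro ⟨i, hi, h'⟩
          exact m.sparse i (Finset.mem_of_mem_erase hi) (h' ▸ hM)
        rw [decide_eq_false hf, Finset.card_erase_of_mem hM] at h
        rw [decide_eq_true hM]
        have h := Run.mark h
        rwa [Nat.sub_add_cancel (Finset.card_pos.2 ⟨_, hM⟩)] at h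
      · rw [decide_eq_false hM]
        rw [Finset.erase_eq_of_notMem hM] at h
        by_cases hf : ∃ i ∈ M, i + 1 = w.count U
        · rw [decide_eq_true hf] at h
          obtain ⟨i, hi, h'⟩ := hf
          rcases w with _ | ⟨s, w⟩
          · simp at h'
          · cases s with
            | D => exact Run.up_down h
            | U =>
              refine absurd hi ?_
              simp only [List.count_cons_self, add_left_inj] at h'
              exact h' ▸ m.separated [] w rfl
        · rw [decide_eq_false hf] at h
          exact Run.up h

theorem Run.exists_markable {b n k h w} (r : Run b n k h w) :
    ∃ v M, Markable v M ∧ label M v = w ∧ v.count U = n ∧ M.card = k ∧ v.count D + h = n ∧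
      (b = true ↔ ∃ i ∈ M, i + 1 = n) := by
  induction r with
  | nil =>
    refine ⟨[], ∅, ⟨?_, ?_, ?_, ?_⟩, rfl, rfl, rfl, rfl, by simp⟩ <;> simp
  | @down b n k h w r ih =>
    obtain ⟨v, M, m, hl, hn, hk, hh, hb⟩ := ih
    refine ⟨D :: v, M, ⟨?_, ?_, m.sparse, ?_⟩, by simp [label, hl], by simpa using hn, hk,
      by simp; omega, hb⟩
    · intro u hu
      rcases List.suffix_cons_iff.1 hu with rfl | hu
      · simp; omega
      · exact m.balanced u hu
    · simpa using m.lt_count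
    · intro l r h
      rcases l with _ | ⟨s, l⟩
      · simp at h
      · exact m.separated l r (List.cons.inj h).2
  | @up n k h w r ih =>
    obtain ⟨v, M, m, hl, hn, hk, hh, hb⟩ := ih
    have hnM : n ∉ M := fun hM => by
      have := m.lt_count n hM
      omega
    refine ⟨U :: v, M, ⟨?_, ?_, m.sparse, ?_⟩, by simp [label, hl, hn, hnM], by simpa using hn, hk,
      by simp; omega, by simpa using hnM⟩
    · intro u hu
      rcases List.suffix_cons_iff.1 hu with rfl | hu
      · simp; omega
      · exact m.balanced u hu
    · intro i hi
      have := m.lt_count i hi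
      simp; omega
    · intro l r h
      rcases l with _ | ⟨s, l⟩
      · obtain rfl := (List.cons.inj h).2
        intro hM
        have := hb.2 ⟨_, hM, by rw [← hn]; simp⟩
        simp at this
      · exact m.separated l r (List.cons.inj h).2
  | @up_down n k h w r ih =>
    obtain ⟨v, M, m, hl, hn, hk, hh, hb⟩ := ih
    have hnM : n ∉ M := fun hM => by
      have := m.lt_count n hM
      omega
    refine ⟨U :: v, M, ⟨?_, ?_, m.sparse, ?_⟩, by simp [label, hl, hn, hnM], by simpa using hn, hk,
      by simp; omega, by simpa using hnM⟩
    · intro u hu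
      rcases List.suffix_cons_iff.1 hu with rfl | hu
      · simp; omega
      · exact m.balanced u hu
    · intro i hi
      have := m.lt_count i hi
      simp; omega
    · intro l r h
      rcases l with _ | ⟨s, l⟩
      · obtain rfl := (List.cons.inj h).2
        simp [label] at hl
      · exact m.separated l r (List.cons.inj h).2
  | @mark n k h w r ih =>
    obtain ⟨v, M, m, hl, hn, hk, hh, hb⟩ := ih
    have hnM : n ∉ M := fun hM => by
      have := m.lt_count n hM
      omega
    have hM : ∀ i ∈ M, i < n := fun i hi => hn ▸ m.lt_count i hi
    refine ⟨U :: v, insert n M, ⟨?_, ?_, ?_, ?_⟩, ?_, by simpa using hn, by simp [hnM, hk],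
      by simp; omega, by simp⟩
    · intro u hu
      rcases List.suffix_cons_iff.1 hu with rfl | hu
      · simp; omega
      · exact m.balanced u hu
    · intro i hi
      rcases Finset.mem_insert.1 hi with rfl | hi
      · simp [hn]
      · have := hM i hi
        simp; omega
    · intro i hi hi'
      rcases Finset.mem_insert.1 hi with rfl | hi
      · rcases Finset.mem_insert.1 hi' with h' | h'
        · omega
        · have := hM _ h'
          omega
      · rcases Finset.mem_insert.1 hi' with h' | h'
        · have := hb.2 ⟨i, hi, h'⟩
          simp at this
        · exact m.sparse i hi h'
    · intro l r h hr
      rcases Finset.mem_insert.1 hr with hr | hr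
      · have := congrArg (List.count U) h
        simp at this
        omega
      · rcases l with _ | ⟨s, l⟩
        · obtain rfl := (List.cons.inj h).2
          have := hb.2 ⟨_, hr, by rw [← hn]; simp⟩
          simp at this
        · exact m.separated l r (List.cons.inj h).2 hr
    · simp only [label, hn, Finset.mem_insert_self, decide_true]
      rw [label_congr v (M' := M) fun i hi => by simp; omega, hl]

end Labels

/-! ### Permutations avoiding 231, 312 and 321 -/

section Permutations

variable {n : ℕ}

/-- The positions of the descents of `π`. -/
def descentSet (π : Equiv.Perm (Fin n)) : Finset ℕ :=
  (Finset.univ.filter fun i : Fin n => ∃ j : Fin n, (j : ℕ) = i + 1 ∧ π j < π i).map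
    Fin.valEmbedding

theorem mem_descentSet {π : Equiv.Perm (Fin n)} {x : ℕ} :
    x ∈ descentSet π ↔ ∃ i j : Fin n, (i : ℕ) = x ∧ (j : ℕ) = x + 1 ∧ π j < π i := by
  simp only [descentSet, Finset.mem_map, Finset.mem_filter, Finset.mem_univ, true_and,
    Fin.valEmbedding_apply]
  constructor
  · rintro ⟨i, ⟨j, hj, h⟩, rfl⟩
    exact ⟨i, j, rfl, hj, h⟩
  · rintro ⟨i, j, rfl, hj, h⟩
    exact ⟨i, ⟨j, hj, h⟩, rfl⟩

theorem card_descentSet (π : Equiv.Perm (Fin n)) : (descentSet π).card = descents π := by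
  rw [descentSet, Finset.card_map, descents, ← Set.ncard_coe_finset]
  congr 1
  ext i
  simp

theorem contains_of_strictMono {π : Equiv.Perm (Fin n)} {ρ : Equiv.Perm (Fin 3)} {i j l : Fin n}
    (hij : i < j) (hjl : j < l) (h : ∀ a b : Fin 3, π (![i, j, l] a) ≤ π (![i, j, l] b) ↔
      ρ a ≤ ρ b) : Contains π ρ := by
  refine ⟨![i, j, l], ?_, h⟩
  rw [Fin.strictMono_iff_lt_succ]
  intro a
  fin_cases a
  · exact hij
  · exact hjl

theorem avoids_iff (π : Equiv.Perm (Fin n)) : (∀ ρ ∈ patterns, ¬ Contains π ρ.2) ↔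
    ∀ i l : Fin n, (i : ℕ) + 2 ≤ l → π i < π l := by
  constructor
  · intro h i l hil
    by_contra hlt
    have hne : π i ≠ π l := fun h' => by
      have := π.injective h'
      subst this
      omega
    have hli : π l < π i := lt_of_le_of_ne (not_lt.1 hlt) hne.symm
    -- Any position strictly between the two ends of the inversion would do; comparing its value
    -- with theirs decides which of the three patterns occurs.
    let j : Fin n := ⟨i + 1, by omega⟩
    have hij : i < j := by simp [j, Fin.lt_def]
    have hjl : j < l := by simp [j, Fin.lt_def]; omega
    have h1 : π j ≠ π i := fun h' => hij.ne' (π.injective h')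
    have h2 : π j ≠ π l := fun h' => hjl.ne (π.injective h')
    rcases lt_or_gt_of_ne h1 with h1 | h1
    · rcases lt_or_gt_of_ne h2 with h2 | h2
      · refine h ⟨3, p312⟩ (by simp [patterns]) (contains_of_strictMono hij hjl ?_)
        intro a b
        fin_cases a <;> fin_cases b <;> simp [p312] <;> order
      · refine h ⟨3, p321⟩ (by simp [patterns]) (contains_of_strictMono hij hjl ?_)
        intro a b
        fin_cases a <;> fin_cases b <;> simp [p321] <;> order
    · refine h ⟨3, p231⟩ (by simp [patterns]) (contains_of_strictMono hij hjl ?_)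
      intro a b
      fin_cases a <;> fin_cases b <;> simp [p231] <;> order
  · intro h ρ hρ
    have key : ∀ ρ : Equiv.Perm (Fin 3), ρ 2 < ρ 0 → ¬ Contains π ρ := by
      rintro ρ hρ ⟨f, hf, hfρ⟩
      have h01 : f 0 < f 1 := hf (by decide)
      have h12 : f 1 < f 2 := hf (by decide)
      have := h (f 0) (f 2) (by simp only [Fin.lt_def] at h01 h12; omega)
      exact absurd ((hfρ 0 2).1 this.le) (not_le.2 hρ)
    simp only [patterns, Set.mem_insert_iff, Set.mem_singleton_iff] at hρ
    rcases hρ with rfl | rfl | rfl <;> exact key _ (by decide)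

/-- Two successive descents would invert entries at distance two. -/
theorem sparse_descentSet {π : Equiv.Perm (Fin n)}
    (h : ∀ i l : Fin n, (i : ℕ) + 2 ≤ l → π i < π l) {x : ℕ} (hx : x ∈ descentSet π) :
    x + 1 ∉ descentSet π := by
  intro hx'
  obtain ⟨i, j, hi, hj, hij⟩ := mem_descentSet.1 hx
  obtain ⟨j', l, hj', hl, hjl⟩ := mem_descentSet.1 hx'
  obtain rfl : j = j' := Fin.ext (by omega)
  exact absurd (h i l (by omega)) (hjl.trans hij).asymm

/-- Distant pairs are always in order and adjacent pairs are governed by the descent set, so `π` and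
`σ` compare all pairs alike. -/
theorem eq_of_descentSet_eq {π σ : Equiv.Perm (Fin n)}
    (hπ : ∀ i l : Fin n, (i : ℕ) + 2 ≤ l → π i < π l)
    (hσ : ∀ i l : Fin n, (i : ℕ) + 2 ≤ l → σ i < σ l)
    (h : descentSet π = descentSet σ) : π = σ := by
  have desc : ∀ {τ : Equiv.Perm (Fin n)} {i l : Fin n}, (l : ℕ) = i + 1 →
      (τ l < τ i ↔ (i : ℕ) ∈ descentSet τ) := by
    intro τ i l hil
    rw [mem_descentSet]
    constructor
    · intro h'
      exact ⟨i, l, rfl, hil, h'⟩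
    · rintro ⟨i', l', hi', hl', h'⟩
      obtain rfl : i' = i := Fin.ext hi'
      obtain rfl : l' = l := Fin.ext (by omega)
      exact h'
  have lt_iff : ∀ i l : Fin n, i < l → (π i < π l ↔ σ i < σ l) := by
    intro i l hil
    rcases Nat.lt_or_ge (i + 1 : ℕ) l with h2 | h2
    · exact iff_of_true (hπ i l h2) (hσ i l h2)
    · have hl : (l : ℕ) = i + 1 := by
        have := Fin.lt_def.1 hil
        omega
      have e : π l < π i ↔ σ l < σ i := by rw [desc hl, desc hl, h]
      have h1 : π l ≠ π i := fun h' => hil.ne' (π.injective h')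
      have h3 : σ l ≠ σ i := fun h' => hil.ne' (σ.injective h')
      rw [← not_le, ← not_le, h1.le_iff_lt, h3.le_iff_lt, e]
  have lt_iff' : ∀ i l : Fin n, π i < π l ↔ σ i < σ l := by
    intro i l
    rcases lt_trichotomy i l with hil | rfl | hil
    · exact lt_iff i l hil
    · simp
    · have h1 : π i ≠ π l := fun h' => hil.ne' (π.injective h')
      have h3 : σ i ≠ σ l := fun h' => hil.ne' (σ.injective h')
      rw [← not_le, ← not_le, h1.symm.le_iff_lt, h3.symm.le_iff_lt, lt_iff l i hil]
  -- The map from values of `π` to values of `σ` preserves order, and a finite chain has no order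
  -- automorphism but the identity.
  let e : Fin n ≃o Fin n :=
    { π.symm.trans σ with
      map_rel_iff' := by
        intro a b
        have := lt_iff' (π.symm b) (π.symm a)
        simp only [Equiv.apply_symm_apply] at this
        simp only [Equiv.trans_apply]
        rw [← not_lt, ← not_lt, this] }
  have he : e = OrderIso.refl _ := Subsingleton.elim _ _
  ext i : 1
  have := congrArg (fun f : Fin n ≃o Fin n => f (π i)) he
  simpa [e] using this.symm

/-- Exchanges `i` and `i + 1` for every `i ∈ M`. -/
def swapAdjacent (M : Finset ℕ) (i : ℕ) : ℕ :=
  if i ∈ M then i + 1 else if 1 ≤ i ∧ i - 1 ∈ M then i - 1 else i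

theorem swapAdjacent_swapAdjacent {M : Finset ℕ} (hM : ∀ i ∈ M, i + 1 ∉ M) (i : ℕ) :
    swapAdjacent M (swapAdjacent M i) = i := by
  by_cases h1 : i ∈ M
  · simp [swapAdjacent, h1, hM i h1]
  · by_cases h2 : 1 ≤ i ∧ i - 1 ∈ M
    · simp only [swapAdjacent, h1, h2, if_false, and_self, if_true]
      omega
    · simp [swapAdjacent, h1, h2]

theorem swapAdjacent_lt {M : Finset ℕ} (hM : ∀ i ∈ M, i + 1 < n) {i : ℕ} (hi : i < n) :
    swapAdjacent M i < n := by
  unfold swapAdjacent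
  split_ifs with h1 h2
  · exact hM i h1
  · omega
  · exact hi

/-- The product of the transpositions of `i` and `i + 1` for `i ∈ M`. -/
def layeredPerm (M : Finset ℕ) (hM : ∀ i ∈ M, i + 1 ∉ M) (hn : ∀ i ∈ M, i + 1 < n) :
    Equiv.Perm (Fin n) :=
  Function.Involutive.toPerm (fun i => ⟨swapAdjacent M i, swapAdjacent_lt hn i.2⟩)
    fun i => Fin.ext (swapAdjacent_swapAdjacent hM i)

theorem coe_layeredPerm (M : Finset ℕ) (hM : ∀ i ∈ M, i + 1 ∉ M) (hn : ∀ i ∈ M, i + 1 < n)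
    (i : Fin n) : (layeredPerm M hM hn i : ℕ) = swapAdjacent M i := rfl

/-- Each value moves by at most one, which gives the weak inequality; injectivity of the involution
makes it strict. -/
theorem layeredPerm_lt (M : Finset ℕ) (hM : ∀ i ∈ M, i + 1 ∉ M) (hn : ∀ i ∈ M, i + 1 < n)
    (i l : Fin n) (hil : (i : ℕ) + 2 ≤ l) : layeredPerm M hM hn i < layeredPerm M hM hn l := by
  have hle : swapAdjacent M i ≤ i + 1 := by
    unfold swapAdjacent
    split_ifs <;> omega
  have hge : (l : ℕ) ≤ swapAdjacent M l + 1 := by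
    unfold swapAdjacent
    split_ifs <;> omega
  have hne : swapAdjacent M i ≠ swapAdjacent M l := fun h => by
    have := congrArg (swapAdjacent M) h
    rw [swapAdjacent_swapAdjacent hM, swapAdjacent_swapAdjacent hM] at this
    omega
  rw [Fin.lt_def, coe_layeredPerm, coe_layeredPerm]
  omega

theorem descentSet_layeredPerm (M : Finset ℕ) (hM : ∀ i ∈ M, i + 1 ∉ M)
    (hn : ∀ i ∈ M, i + 1 < n) : descentSet (layeredPerm M hM hn) = M := by
  ext x
  rw [mem_descentSet]
  constructor
  · rintro ⟨i, j, rfl, hj, h⟩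
    rw [Fin.lt_def, coe_layeredPerm, coe_layeredPerm, hj] at h
    by_contra hx
    have h1 : swapAdjacent M i ≤ i := by
      simp only [swapAdjacent, hx, if_false]
      split_ifs <;> omega
    have h2 : (i : ℕ) < swapAdjacent M (i + 1) := by
      simp only [swapAdjacent, Nat.add_sub_cancel, hx, and_false, if_false]
      split_ifs <;> omega
    omega
  · intro hx
    have := hn x hx
    refine ⟨⟨x, by omega⟩, ⟨x + 1, this⟩, rfl, rfl, ?_⟩
    rw [Fin.lt_def, coe_layeredPerm, coe_layeredPerm]
    simp [swapAdjacent, hx, hM x hx]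

end Permutations

/-! ### Avoiding parking functions as marked Dyck paths -/

section ParkingFunctions

open DyckStep

variable {n : ℕ}

theorem markable_descentSet (p : AvoidingParkingFunction n patterns) :
    Markable p.1.path.toList.reverse (descentSet p.1.perm) where
  balanced v hv := by
    rw [← List.reverse_prefix, List.reverse_reverse] at hv
    have := p.1.path.count_D_le_count_U v.reverse.length
    rw [← List.prefix_iff_eq_take.1 hv] at this
    simpa using this
  lt_count i hi := by
    obtain ⟨i, -, rfl, -⟩ := mem_descentSet.1 hi
    have h : p.1.path.toList.count U = n := p.1.semilength_path
    rw [List.count_reverse, h]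
    exact i.2
  sparse i hi := sparse_descentSet ((avoids_iff _).1 p.2) hi
  separated l r h hr := by
    obtain ⟨i, j, hi, hj, hij⟩ := mem_descentSet.1 hr
    refine absurd hij (p.1.increasing r.reverse l.reverse i j ?_ ?_ ?_).asymm
    · rw [← List.reverse_reverse p.1.path.toList, h]
      simp
    · simpa using hi
    · simpa using hj

/-- The path of `p` with the descents of its permutation marked. -/
def word (p : AvoidingParkingFunction n patterns) : List (Option Bool) :=
  label (descentSet p.1.perm) p.1.path.toList.reverse

theorem word_mem_runs (p : AvoidingParkingFunction n patterns) :
    word p ∈ runs false n (descents p.1.perm) 0 := by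
  have h := (markable_descentSet p).run
  have hU : p.1.path.toList.count U = n := p.1.semilength_path
  have hD : p.1.path.toList.count D = n := p.1.path.count_U_eq_count_D.symm.trans hU
  have hlast : ¬ ∃ i ∈ descentSet p.1.perm, i + 1 = n := by
    rintro ⟨i, hi, h'⟩
    obtain ⟨i, j, rfl, hj, -⟩ := mem_descentSet.1 hi
    have := j.2
    omega
  rw [List.count_reverse, List.count_reverse, hU, hD, Nat.sub_self, decide_eq_false hlast,
    card_descentSet] at h
  exact h

theorem word_injective : Function.Injective (word (n := n)) := by
  rintro ⟨⟨path, hn, π, inc⟩, hp⟩ ⟨⟨path', hn', π', inc'⟩, hp'⟩ h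
  obtain ⟨h1, h2⟩ := label_injective h
  have hpath : path = path' := DyckWord.ext (List.reverse_injective h1)
  subst hpath
  have hπ : π = π' := by
    refine eq_of_descentSet_eq ((avoids_iff _).1 hp) ((avoids_iff _).1 hp') ?_
    ext i
    have hU : path.toList.count U = n := hn
    simp only [List.count_reverse, hU] at h2
    by_cases hi : i < n
    · exact h2 i hi
    · refine iff_of_false ?_ ?_ <;>
      · intro h'
        obtain ⟨i, -, rfl, -⟩ := mem_descentSet.1 h'
        exact hi i.2
  subst hπ
  rfl

theorem exists_word_eq {k : ℕ} {w : List (Option Bool)} (hw : w ∈ runs false n k 0) :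
    ∃ p : AvoidingParkingFunction n patterns, descents p.1.perm = k ∧ word p = w := by
  obtain ⟨v, M, m, rfl, hU, rfl, hD, hb⟩ := Run.exists_markable hw
  -- The flag `false` says that index `n - 1` is unmarked, so every transposition of `i` and `i + 1`
  -- stays inside `Fin n`.
  have hlt : ∀ i ∈ M, i + 1 < n := by
    intro i hi
    have h1 := m.lt_count i hi
    have h2 : i + 1 ≠ n := fun h' => Bool.false_ne_true (hb.2 ⟨i, hi, h'⟩)
    omega
  have hdesc := descentSet_layeredPerm M m.sparse hlt
  let path : DyckWord :=
    { toList := v.reverse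
      count_U_eq_count_D := by rw [List.count_reverse, List.count_reverse]; omega
      count_D_le_count_U := fun i => by
        have := m.balanced (v.reverse.take i).reverse (by
          rw [← List.reverse_prefix, List.reverse_reverse]
          exact List.take_prefix _ _)
        simpa using this }
  let p : ParkingFunction n :=
    { path := path
      semilength_path := by
        simp only [path, DyckWord.semilength, List.count_reverse]
        exact hU
      perm := layeredPerm M m.sparse hlt
      increasing := by
        intro l₁ l₂ i j h hi hj
        have hv : v = l₂.reverse ++ U :: U :: l₁.reverse := by
          rw [← List.reverse_reverse v]
          simp only [path] at h
          rw [h]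
          simp
        have hi' := m.separated _ _ hv
        rw [List.count_reverse, ← hi, ← hdesc, mem_descentSet] at hi'
        have hne : layeredPerm M m.sparse hlt i ≠ layeredPerm M m.sparse hlt j := fun h' => by
          have := congrArg Fin.val ((layeredPerm M m.sparse hlt).injective h')
          omega
        refine lt_of_le_of_ne (not_lt.1 fun h' => hi' ⟨i, j, rfl, by omega, h'⟩) hne }
  refine ⟨⟨p, (avoids_iff _).2 (layeredPerm_lt M m.sparse hlt)⟩, ?_, ?_⟩
  · rw [← card_descentSet]
    simp only [p, hdesc]
  · simp only [word, p, path, hdesc, List.reverse_reverse]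

theorem card_avoiding_descents (n k : ℕ) :
    Nat.card {p : AvoidingParkingFunction n patterns // descents p.1.perm = k} =
      (runs false n k 0).ncard := by
  rw [← Nat.card_coe_set_eq]
  refine Nat.card_congr (Equiv.ofBijective
    (fun p => ⟨word p.1, by simpa only [p.2] using word_mem_runs p.1⟩) ⟨?_, ?_⟩)
  · intro p q h
    exact Subtype.ext (word_injective (congrArg Subtype.val h))
  · rintro ⟨w, hw⟩
    obtain ⟨p, hp, rfl⟩ := exists_word_eq hw
    exact ⟨⟨p, hp⟩, rfl⟩

theorem finite_avoiding (n : ℕ) : Finite (AvoidingParkingFunction n patterns) := by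
  have hfin : {w : List (Option Bool) | w.length ≤ 2 * n}.Finite := List.finite_length_le _ _
  have hword : ∀ p : AvoidingParkingFunction n patterns,
      word p ∈ {w : List (Option Bool) | w.length ≤ 2 * n} := fun p => by
    have := Run.length_eq (word_mem_runs p)
    simp only [Set.mem_ofPred_eq]
    omega
  have := hfin.to_subtype
  exact Finite.of_injective (Set.codRestrict word _ hword)
    ((Set.injective_codRestrict hword).2 word_injective)

end ParkingFunctions

/-! ### Counting plane trees and forests with binary and ternary vertices -/

/-- Plane trees all of whose inner vertices have two or three children. -/
inductive BTTree : Type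
  | leaf : BTTree
  | tri : BTTree → BTTree → BTTree
  | quad : BTTree → BTTree → BTTree → BTTree

namespace BTTree

/-- The number of inner vertices with two children. -/
def tris : BTTree → ℕ
  | leaf => 0
  | tri l r => l.tris + r.tris + 1
  | quad l c r => l.tris + c.tris + r.tris

/-- The number of inner vertices with three children. -/
def quads : BTTree → ℕ
  | leaf => 0
  | tri l r => l.quads + r.quads
  | quad l c r => l.quads + c.quads + r.quads + 1

/-- The number of leaves. -/
def leaves : BTTree → ℕ
  | leaf => 1
  | tri l r => l.leaves + r.leaves
  | quad l c r => l.leaves + c.leaves + r.leaves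

theorem leaves_eq (t : BTTree) : t.leaves = t.tris + 2 * t.quads + 1 := by
  induction t <;> simp only [leaves, tris, quads] <;> omega

theorem leaves_pos (t : BTTree) : 0 < t.leaves := by
  rw [leaves_eq]
  omega

/-- The plane forests with `h` trees, `u` binary and `v` ternary inner vertices. -/
def forests (h u v : ℕ) : Set (List BTTree) :=
  {l | l.length = h ∧ (l.map tris).sum = u ∧ (l.map quads).sum = v}

theorem mem_forests {h u v : ℕ} {l : List BTTree} :
    l ∈ forests h u v ↔ l.length = h ∧ (l.map tris).sum = u ∧ (l.map quads).sum = v := Iff.rfl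

theorem forests_zero_zero_zero : forests 0 0 0 = {[]} := by
  ext l
  simp only [mem_forests, Set.mem_singleton_iff]
  constructor
  · rintro ⟨h, -, -⟩
    exact List.length_eq_zero_iff.1 h
  · rintro rfl
    simp

theorem forests_zero_of_ne {u v : ℕ} (h : u ≠ 0 ∨ v ≠ 0) : forests 0 u v = ∅ := by
  refine Set.eq_empty_of_forall_notMem fun l hl => ?_
  obtain ⟨h1, h2, h3⟩ := hl
  obtain rfl := List.length_eq_zero_iff.1 h1
  simp at h2 h3
  omega

/-- Forests whose first tree has a binary root. -/
def triForests (h u v : ℕ) : Set (List BTTree) :=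
  {l | l ∈ forests (h + 1) u v ∧ ∃ a b l', l = tri a b :: l'}

/-- Forests whose first tree has a ternary root. -/
def quadForests (h u v : ℕ) : Set (List BTTree) :=
  {l | l ∈ forests (h + 1) u v ∧ ∃ a b c l', l = quad a b c :: l'}

theorem forests_succ (h u v : ℕ) : forests (h + 1) u v =
    List.cons leaf '' forests h u v ∪ (triForests h u v ∪ quadForests h u v) := by
  ext l
  constructor
  · intro hl
    rcases l with _ | ⟨t, l⟩
    · simp [mem_forests] at hl
    · cases t with
      | leaf =>
        refine Or.inl ⟨l, ?_, rfl⟩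
        simpa [mem_forests, tris, quads] using hl
      | tri a b => exact Or.inr (Or.inl ⟨hl, a, b, l, rfl⟩)
      | quad a b c => exact Or.inr (Or.inr ⟨hl, a, b, c, l, rfl⟩)
  · rintro (⟨l, hl, rfl⟩ | hl | hl)
    · simpa [mem_forests, tris, quads] using hl
    · exact hl.1
    · exact hl.1

/-- Replaces the first two trees by a tree with a binary root. -/
def joinTri : List BTTree → List BTTree
  | a :: b :: l => tri a b :: l
  | l => l

/-- Replaces the first three trees by a tree with a ternary root. -/
def joinQuad : List BTTree → List BTTree
  | a :: b :: c :: l => quad a b c :: l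
  | l => l

theorem exists_cons_cons {h u v : ℕ} {l : List BTTree} (hl : l ∈ forests (h + 2) u v) :
    ∃ a b l', l = a :: b :: l' := by
  rcases l with _ | ⟨a, _ | ⟨b, l⟩⟩
  · simp [mem_forests] at hl
  · simp [mem_forests] at hl
  · exact ⟨a, b, l, rfl⟩

theorem exists_cons_cons_cons {h u v : ℕ} {l : List BTTree} (hl : l ∈ forests (h + 3) u v) :
    ∃ a b c l', l = a :: b :: c :: l' := by
  rcases l with _ | ⟨a, _ | ⟨b, _ | ⟨c, l⟩⟩⟩
  · simp [mem_forests] at hl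
  · simp [mem_forests] at hl
  · simp [mem_forests] at hl
  · exact ⟨a, b, c, l, rfl⟩

theorem triForests_zero (h v : ℕ) : triForests h 0 v = ∅ := by
  refine Set.eq_empty_of_forall_notMem ?_
  rintro _ ⟨hl, a, b, l, rfl⟩
  simp [mem_forests, tris] at hl

theorem quadForests_zero (h u : ℕ) : quadForests h u 0 = ∅ := by
  refine Set.eq_empty_of_forall_notMem ?_
  rintro _ ⟨hl, a, b, c, l, rfl⟩
  simp [mem_forests, quads] at hl

theorem triForests_succ (h u v : ℕ) :
    triForests h (u + 1) v = joinTri '' forests (h + 2) u v := by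
  ext l
  constructor
  · rintro ⟨hl, a, b, l, rfl⟩
    refine ⟨a :: b :: l, ?_, rfl⟩
    simp only [mem_forests, List.length_cons, List.map_cons, List.sum_cons, tris, quads] at hl ⊢
    omega
  · rintro ⟨l, hl, rfl⟩
    obtain ⟨a, b, l, rfl⟩ := exists_cons_cons hl
    refine ⟨?_, a, b, l, rfl⟩
    simp only [joinTri, mem_forests, List.length_cons, List.map_cons, List.sum_cons, tris,
      quads] at hl ⊢
    omega

theorem quadForests_succ (h u v : ℕ) :
    quadForests h u (v + 1) = joinQuad '' forests (h + 3) u v := by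
  ext l
  constructor
  · rintro ⟨hl, a, b, c, l, rfl⟩
    refine ⟨a :: b :: c :: l, ?_, rfl⟩
    simp only [mem_forests, List.length_cons, List.map_cons, List.sum_cons, tris, quads] at hl ⊢
    omega
  · rintro ⟨l, hl, rfl⟩
    obtain ⟨a, b, c, l, rfl⟩ := exists_cons_cons_cons hl
    refine ⟨?_, a, b, c, l, rfl⟩
    simp only [joinQuad, mem_forests, List.length_cons, List.map_cons, List.sum_cons, tris,
      quads] at hl ⊢
    omega

theorem injOn_joinTri (h u v : ℕ) : Set.InjOn joinTri (forests (h + 2) u v) := by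
  intro l hl l' hl' e
  obtain ⟨a, b, l, rfl⟩ := exists_cons_cons hl
  obtain ⟨a', b', l', rfl⟩ := exists_cons_cons hl'
  simpa [joinTri, and_assoc] using e

theorem injOn_joinQuad (h u v : ℕ) : Set.InjOn joinQuad (forests (h + 3) u v) := by
  intro l hl l' hl' e
  obtain ⟨a, b, c, l, rfl⟩ := exists_cons_cons_cons hl
  obtain ⟨a', b', c', l', rfl⟩ := exists_cons_cons_cons hl'
  simpa [joinQuad, and_assoc] using e

theorem finite_forests (h u v : ℕ) : (forests h u v).Finite := by
  -- This quantity is the total number of vertices of the forest, leaves included. Removing the root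
  -- of the first tree lowers it by one.
  induction hm : h + 2 * u + 3 * v using Nat.strong_induction_on generalizing h u v with
  | _ m ih =>
    rcases h with _ | h
    · refine (Set.finite_singleton []).subset fun l hl => ?_
      exact List.length_eq_zero_iff.1 hl.1
    · rw [forests_succ]
      refine ((ih _ (by omega) h u v rfl).image _).union (Set.Finite.union ?_ ?_)
      · rcases u with _ | u
        · rw [triForests_zero]
          exact Set.finite_empty
        · rw [triForests_succ]
          exact (ih _ (by omega) (h + 2) u v rfl).image _
      · rcases v with _ | v
        · rw [quadForests_zero]
          exact Set.finite_empty
        · rw [quadForests_succ]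
          exact (ih _ (by omega) (h + 3) u v rfl).image _

theorem ncard_forests_succ (h u v : ℕ) : (forests (h + 1) u v).ncard =
    (forests h u v).ncard + ((triForests h u v).ncard + (quadForests h u v).ncard) := by
  have hf := finite_forests (h + 1) u v
  have h1 : (triForests h u v).Finite := hf.subset fun l hl => hl.1
  have h2 : (quadForests h u v).Finite := hf.subset fun l hl => hl.1
  rw [forests_succ, Set.ncard_union_eq _ ((finite_forests _ _ _).image _) (h1.union h2),
    Set.ncard_union_eq _ h1 h2, Set.ncard_image_of_injective _ (cons_injective _)]
  · rw [Set.disjoint_left]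
    rintro _ ⟨-, a, b, l, rfl⟩ ⟨-, a', b', c', l', h'⟩
    simp at h'
  · rw [Set.disjoint_left]
    rintro _ ⟨l, -, rfl⟩ (⟨-, a, b, l', h'⟩ | ⟨-, a, b, c, l', h'⟩) <;> simp at h'

theorem ncard_triForests_succ (h u v : ℕ) :
    (triForests h (u + 1) v).ncard = (forests (h + 2) u v).ncard := by
  rw [triForests_succ, (injOn_joinTri h u v).ncard_image]

theorem ncard_quadForests_succ (h u v : ℕ) :
    (quadForests h u (v + 1)).ncard = (forests (h + 3) u v).ncard := by
  rw [quadForests_succ, (injOn_joinQuad h u v).ncard_image]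

-- Here `h + 1 + u + 2 * v` is the number of leaves. Deleting the root of the first tree leaves a
-- forest with `h`, `h + 2` or `h + 3` trees, according to whether that root is a leaf, binary or
-- ternary.
open Nat in
theorem ncard_forests_mul (h u v : ℕ) :
    (forests (h + 1) u v).ncard * ((h + 1 + u + 2 * v)! * u ! * v !) =
      (h + 1) * (h + 2 * u + 3 * v)! := by
  induction hm : h + 2 * u + 3 * v using Nat.strong_induction_on generalizing h u v with
  | _ m ih =>
    subst hm
    by_cases h0 : h = 0 ∧ u = 0 ∧ v = 0
    · obtain ⟨rfl, rfl, rfl⟩ := h0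
      rw [ncard_forests_succ, triForests_zero, quadForests_zero, forests_zero_zero_zero]
      simp
    obtain ⟨m, hm⟩ : ∃ m, h + 2 * u + 3 * v = m + 1 := ⟨h + 2 * u + 3 * v - 1, by omega⟩
    have e0 : (forests h u v).ncard * ((h + 1 + u + 2 * v)! * u ! * v !) =
        h * (h + 1 + u + 2 * v) * m ! := by
      rcases h with _ | h
      · rw [forests_zero_of_ne (by omega)]
        simp
      · have := ih _ (by omega) h u v rfl
        rw [show h + 2 * u + 3 * v = m by omega] at this
        rw [show h + 1 + 1 + u + 2 * v = (h + 1 + u + 2 * v) + 1 by ring, Nat.factorial_succ]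
        linear_combination (h + 1 + u + 2 * v + 1) * this
    have e1 : (triForests h u v).ncard * ((h + 1 + u + 2 * v)! * u ! * v !) =
        (h + 2) * u * m ! := by
      rcases u with _ | u
      · rw [triForests_zero]
        simp
      · have := ih _ (by omega) (h + 1) u v rfl
        rw [show h + 1 + 2 * u + 3 * v = m by omega] at this
        rw [ncard_triForests_succ, Nat.factorial_succ u,
          show h + 1 + (u + 1) + 2 * v = h + 1 + 1 + u + 2 * v by ring]
        linear_combination (u + 1) * this
    have e2 : (quadForests h u v).ncard * ((h + 1 + u + 2 * v)! * u ! * v !) =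
        (h + 3) * v * m ! := by
      rcases v with _ | v
      · rw [quadForests_zero]
        simp
      · have := ih _ (by omega) (h + 2) u v rfl
        rw [show h + 2 + 2 * u + 3 * v = m by omega] at this
        rw [ncard_quadForests_succ, Nat.factorial_succ v,
          show h + 1 + u + 2 * (v + 1) = h + 2 + 1 + u + 2 * v by ring]
        linear_combination (v + 1) * this
    -- The contributions add up because `h * (h + 1 + u + 2 * v) + (h + 2) * u + (h + 3) * v`
    -- factors as `(h + 1) * (h + 2 * u + 3 * v)`.
    rw [ncard_forests_succ, add_mul, add_mul, e0, e1, e2, hm, Nat.factorial_succ, ← hm]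
    ring

/-- The trees with `n + 1` leaves and `k` ternary vertices. -/
def treesWith (n k : ℕ) : Set BTTree := {t | t.leaves = n + 1 ∧ t.quads = k}

theorem mem_treesWith {n k : ℕ} {t : BTTree} :
    t ∈ treesWith n k ↔ t.leaves = n + 1 ∧ t.quads = k := Iff.rfl

theorem forests_one (u v : ℕ) :
    forests 1 u v = (fun t => [t]) '' treesWith (u + 2 * v) v := by
  ext l
  constructor
  · intro hl
    obtain ⟨t, rfl⟩ := List.length_eq_one_iff.1 hl.1
    refine ⟨t, ?_, rfl⟩
    simp only [mem_forests, List.length_singleton, List.map_cons, List.map_nil, List.sum_cons,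
      List.sum_nil] at hl
    rw [mem_treesWith, leaves_eq]
    omega
  · rintro ⟨t, ht, rfl⟩
    rw [mem_treesWith, leaves_eq] at ht
    simp only [mem_forests, List.length_singleton, List.map_cons, List.map_nil, List.sum_cons,
      List.sum_nil, true_and, add_zero]
    omega

theorem treesWith_eq_empty {n k : ℕ} (h : n < 2 * k) : treesWith n k = ∅ := by
  refine Set.eq_empty_of_forall_notMem fun t ht => ?_
  rw [mem_treesWith, leaves_eq] at ht
  omega

theorem ncard_forests_one (u v : ℕ) :
    (forests 1 u v).ncard = (treesWith (u + 2 * v) v).ncard := by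
  rw [forests_one, Set.ncard_image_of_injective _ fun a b h => List.singleton_injective h]

open Nat in
theorem ncard_treesWith_mul (u v : ℕ) :
    (treesWith (u + 2 * v) v).ncard * ((u + 2 * v + 1)! * u ! * v !) = (2 * u + 3 * v)! := by
  have := ncard_forests_mul 0 u v
  rw [zero_add, ncard_forests_one] at this
  rw [show 0 + 1 + u + 2 * v = u + 2 * v + 1 by ring] at this
  simpa using this

end BTTree

-- With `n = u + 2 * k`, both sides equal `(2 * u + 3 * k)! / ((n + 1)! * u ! * k !)`; for `n < 2 *
-- k` both vanish.
open Nat in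
theorem ncard_treesWith_eq_ncard_runs (n k : ℕ) :
    (BTTree.treesWith n k).ncard = (runs false n k 0).ncard := by
  rcases Nat.lt_or_ge n (2 * k) with h | h
  · rw [BTTree.treesWith_eq_empty h, Set.ncard_empty]
    rcases Nat.lt_or_ge n k with h' | h'
    · symm
      rw [Set.ncard_eq_zero (finite_runs _ _ _ _)]
      refine Set.eq_empty_of_forall_notMem fun w r => ?_
      have := Run.marks_le r
      simp at this
      omega
    · obtain ⟨j, rfl⟩ := Nat.exists_eq_add_of_le' h'
      have := ncard_runs_closed j k
      rw [Nat.choose_eq_zero_of_lt (show j < k by omega), zero_mul] at this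
      simpa [eq_comm] using this
  · obtain ⟨u, rfl⟩ := Nat.exists_eq_add_of_le' h
    have h1 := BTTree.ncard_treesWith_mul u k
    have h2 := ncard_runs_closed (u + k) k
    rw [show u + k + k = u + 2 * k by ring,
      show 2 * (u + k) + k = (u + k) + (u + 2 * k) by ring] at h2
    have h3 := Nat.add_choose_mul_factorial_mul_factorial u k
    have h4 := Nat.add_choose_mul_factorial_mul_factorial (u + k) (u + 2 * k)
    have hpos : 0 < (u + 2 * k + 1)! * u ! * k ! := by positivity
    apply Nat.eq_of_mul_eq_mul_right hpos
    rw [h1, show 2 * u + 3 * k = (u + k) + (u + 2 * k) by ring, ← h4, ← h3, Nat.factorial_succ]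
    calc _ = (u + k).choose k * (u + k + (u + 2 * k)).choose (u + 2 * k) *
          ((u + 2 * k)! * u ! * k !) := by ring
      _ = _ := by rw [← h2]; ring

/-! ### Dissections as systems of chords: the region on a base chord -/

section EdgeSystems

/-- `x` and `y` are neighbours in the cyclic order restricted to `S`. -/
def Adjacent (S : Finset ℕ) (x y : ℕ) : Prop :=
  (∀ c ∈ S, ¬ (x < c ∧ c < y)) ∨ (∀ c ∈ S, ¬ (c < x ∨ y < c))

/-- `S` is the vertex set of a region bounded by the chords in `E`. -/
def IsCell (E : Finset (ℕ × ℕ)) (S : Finset ℕ) : Prop :=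
  3 ≤ S.card ∧ ∀ x ∈ S, ∀ y ∈ S, x < y → (Adjacent S x y ↔ (x, y) ∈ E)

/-- `E` consists of the sides and some non-crossing diagonals of the polygon with vertices
`a, a + 1, …, b`. -/
structure EdgeSystem (a b : ℕ) (E : Finset (ℕ × ℕ)) : Prop where
  bounds : ∀ i j, (i, j) ∈ E → a ≤ i ∧ i < j ∧ j ≤ b
  side : ∀ i, a ≤ i → i < b → (i, i + 1) ∈ E
  root : (a, b) ∈ E
  noncrossing : ∀ i j k l, (i, j) ∈ E → (k, l) ∈ E → i < k → k < j → l ≤ j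

/-- The chords of `E` with both ends between `x` and `y`. -/
def within (E : Finset (ℕ × ℕ)) (x y : ℕ) : Finset (ℕ × ℕ) :=
  E.filter fun p => x ≤ p.1 ∧ p.2 ≤ y

theorem mem_within {E : Finset (ℕ × ℕ)} {x y i j : ℕ} :
    (i, j) ∈ within E x y ↔ (i, j) ∈ E ∧ x ≤ i ∧ j ≤ y := by
  simp [within]

theorem isCell_within {E : Finset (ℕ × ℕ)} {S : Finset ℕ} {x y : ℕ}
    (hS : S ⊆ Finset.Icc x y) : IsCell (within E x y) S ↔ IsCell E S := by
  refine and_congr_right fun _ => forall₂_congr fun i hi => forall₂_congr fun j hj => ?_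
  have h1 := Finset.mem_Icc.1 (hS hi)
  have h2 := Finset.mem_Icc.1 (hS hj)
  rw [mem_within, and_iff_left ⟨h1.1, h2.2⟩]

variable {a b : ℕ} {E : Finset (ℕ × ℕ)} {S S' : Finset ℕ}

theorem EdgeSystem.within (hE : EdgeSystem a b E) {x y : ℕ} (hxy : (x, y) ∈ E) :
    EdgeSystem x y (within E x y) where
  bounds i j h := by
    obtain ⟨h1, h2, h3⟩ := mem_within.1 h
    exact ⟨h2, (hE.bounds i j h1).2.1, h3⟩
  side i h1 h2 := by
    have := hE.bounds x y hxy
    exact mem_within.2 ⟨hE.side i (by omega) (by omega), h1, h2⟩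
  root := mem_within.2 ⟨hxy, le_rfl, le_rfl⟩
  noncrossing i j k l h1 h2 :=
    hE.noncrossing i j k l (mem_within.1 h1).1 (mem_within.1 h2).1

/-- The least and greatest vertices of a cell are cyclic neighbours, hence joined by an edge. This
base locates the cell. -/
theorem IsCell.exists_base (h : IsCell E S) :
    ∃ i j, i ∈ S ∧ j ∈ S ∧ S ⊆ Finset.Icc i j ∧ i + 2 ≤ j ∧ (i, j) ∈ E := by
  have hne : S.Nonempty := Finset.card_pos.1 (by have := h.1; omega)
  have hsub : S ⊆ Finset.Icc (S.min' hne) (S.max' hne) := fun x hx =>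
    Finset.mem_Icc.2 ⟨S.min'_le x hx, S.le_max' x hx⟩
  have hcard := Finset.card_le_card hsub
  rw [Nat.card_Icc] at hcard
  have h3 := h.1
  refine ⟨_, _, S.min'_mem hne, S.max'_mem hne, hsub, by omega,
    (h.2 _ (S.min'_mem hne) _ (S.max'_mem hne) (by omega)).1 (Or.inr fun c hc => ?_)⟩
  have := Finset.mem_Icc.1 (hsub hc)
  omega

theorem EdgeSystem.subset_Icc (hE : EdgeSystem a b E) (h : IsCell E S) :
    S ⊆ Finset.Icc a b := by
  obtain ⟨i, j, -, -, hS, -, hij⟩ := h.exists_base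
  have := hE.bounds i j hij
  exact hS.trans (Finset.Icc_subset_Icc this.1 this.2.2)

theorem exists_consecutive {i j v : ℕ} (hi : i ∈ S) (hj : j ∈ S) (hiv : i < v) (hvj : v < j)
    (hv : v ∉ S) : ∃ p ∈ S, ∃ q ∈ S, p < v ∧ v < q ∧ ∀ c ∈ S, ¬ (p < c ∧ c < q) := by
  have h1 : (S.filter (· < v)).Nonempty := ⟨i, Finset.mem_filter.2 ⟨hi, hiv⟩⟩
  have h2 : (S.filter (v < ·)).Nonempty := ⟨j, Finset.mem_filter.2 ⟨hj, hvj⟩⟩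
  have hp := Finset.mem_filter.1 (Finset.max'_mem _ h1)
  have hq := Finset.mem_filter.1 (Finset.min'_mem _ h2)
  refine ⟨_, hp.1, _, hq.1, hp.2, hq.2, fun c hc h => ?_⟩
  rcases lt_trichotomy c v with hcv | rfl | hcv
  · exact absurd (Finset.le_max' _ c (Finset.mem_filter.2 ⟨hc, hcv⟩)) (not_le.2 h.1)
  · exact hv hc
  · exact absurd (Finset.min'_le _ c (Finset.mem_filter.2 ⟨hc, hcv⟩)) (not_le.2 h.2)

/-- A vertex `v` of `S'` outside `S` lies below an edge `(p, q)` of `S`. If `p` or `q` were missing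
from `S'`, an edge of `S'` would pass over it and cross `(p, q)`. -/
theorem EdgeSystem.cell_subset (hE : EdgeSystem a b E) (h : IsCell E S) (h' : IsCell E S')
    {i j : ℕ} (hi : i ∈ S) (hj : j ∈ S) (hi' : i ∈ S') (hj' : j ∈ S')
    (hS : S ⊆ Finset.Icc i j) (hS' : S' ⊆ Finset.Icc i j) : S' ⊆ S := by
  intro v hv
  by_contra hvS
  have hvij := Finset.mem_Icc.1 (hS' hv)
  have hiv : i < v := lt_of_le_of_ne hvij.1 fun e => hvS (e ▸ hi)
  have hvj : v < j := lt_of_le_of_ne hvij.2 fun e => hvS (e ▸ hj)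
  obtain ⟨p, hp, q, hq, hpv, hvq, hcon⟩ := exists_consecutive hi hj hiv hvj hvS
  have hpq : (p, q) ∈ E := (h.2 p hp q hq (by omega)).1 (Or.inl hcon)
  have hpi := Finset.mem_Icc.1 (hS hp)
  have hqj := Finset.mem_Icc.1 (hS hq)
  have hpS' : p ∈ S' := by
    by_contra hpS'
    have hip : i < p := lt_of_le_of_ne hpi.1 fun e => hpS' (e ▸ hi')
    obtain ⟨c, hc, d, hd, hcp, hpd, hcon'⟩ := exists_consecutive hi' hv hip hpv hpS'
    have hcd : (c, d) ∈ E := (h'.2 c hc d hd (by omega)).1 (Or.inl hcon')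
    have h1 := hE.noncrossing c d p q hcd hpq hcp hpd
    have h2 := hcon' v hv
    omega
  have hqS' : q ∈ S' := by
    by_contra hqS'
    have hqj' : q < j := lt_of_le_of_ne hqj.2 fun e => hqS' (e ▸ hj')
    obtain ⟨c, hc, d, hd, hcq, hqd, hcon'⟩ := exists_consecutive hv hj' hvq hqj' hqS'
    have hcd : (c, d) ∈ E := (h'.2 c hc d hd (by omega)).1 (Or.inl hcon')
    have h2 := hcon' v hv
    have h1 := hE.noncrossing p q c d hpq hcd (by omega) hcq
    omega
  -- As `v` lies between them, `p` and `q` can be neighbours in `S'` only around the outside. They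
  -- are then the ends of the base, which leaves `S` with only two vertices.
  rcases (h'.2 p hpS' q hqS' (by omega)).2 hpq with hadj | hadj
  · exact hadj v hv ⟨hpv, hvq⟩
  · have h1 := hadj i hi'
    have h2 := hadj j hj'
    obtain rfl : p = i := by omega
    obtain rfl : q = j := by omega
    have h3 : S ⊆ {p, q} := fun c hc => by
      have h4 := hcon c hc
      have h5 := Finset.mem_Icc.1 (hS hc)
      rw [Finset.mem_insert, Finset.mem_singleton]
      omega
    have := Finset.card_le_card h3
    have := Finset.card_le_two (a := p) (b := q)
    have := h.1
    omega

theorem EdgeSystem.cell_unique (hE : EdgeSystem a b E) (h : IsCell E S) (h' : IsCell E S')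
    {i j : ℕ} (hi : i ∈ S) (hj : j ∈ S) (hi' : i ∈ S') (hj' : j ∈ S')
    (hS : S ⊆ Finset.Icc i j) (hS' : S' ⊆ Finset.Icc i j) : S = S' :=
  (hE.cell_subset h' h hi' hj' hi hj hS' hS).antisymm (hE.cell_subset h h' hi hj hi' hj' hS hS')

theorem EdgeSystem.exists_cell (hE : EdgeSystem a b E) (hab : a + 2 ≤ b) :
    ∃ S, IsCell E S ∧ a ∈ S ∧ b ∈ S ∧ S ⊆ Finset.Icc a b := by
  -- The region at the base consists of the vertices not hidden below any chord other than the base.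
  let R := (Finset.Icc a b).filter fun v => ∀ p ∈ E, p ≠ (a, b) → ¬ (p.1 < v ∧ v < p.2)
  have mem : ∀ v, v ∈ R ↔ (a ≤ v ∧ v ≤ b) ∧ ∀ p ∈ E, p ≠ (a, b) → ¬ (p.1 < v ∧ v < p.2) := by
    simp [R]
  have ha : a ∈ R := (mem a).2 ⟨by omega, fun p hp _ => by
    have := hE.bounds p.1 p.2 hp
    omega⟩
  have hb : b ∈ R := (mem b).2 ⟨by omega, fun p hp _ => by
    have := hE.bounds p.1 p.2 hp
    omega⟩
  have key : ∀ x ∈ R, ∀ y ∈ R, x < y → (∀ c ∈ R, ¬ (x < c ∧ c < y)) →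
      (x, y) ∈ E ∧ (x, y) ≠ (a, b) := by
    intro x hx y hy hxy hcon
    have hx' := (mem x).1 hx
    have hy' := (mem y).1 hy
    -- The longest edge from `x` ending at or before `y` must reach `y`: otherwise its end is hidden
    -- by a chord, and non-crossing makes that chord a longer edge from `x`.
    let T := (Finset.Icc (x + 1) y).filter fun q => (x, q) ∈ E ∧ (x, q) ≠ (a, b)
    have memT : ∀ q, q ∈ T ↔ (x + 1 ≤ q ∧ q ≤ y) ∧ (x, q) ∈ E ∧ (x, q) ≠ (a, b) := by
      simp [T]
    have hT : T.Nonempty := ⟨x + 1, (memT _).2 ⟨by omega, hE.side x hx'.1.1 (by omega), by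
      rw [Ne, Prod.mk.injEq]
      omega⟩⟩
    obtain ⟨hq1, hq2, hq3⟩ := (memT _).1 (T.max'_mem hT)
    have hmax : ∀ q ∈ T, q ≤ T.max' hT := fun q hq => T.le_max' q hq
    generalize T.max' hT = q at hq1 hq2 hq3 hmax
    rcases hq1.2.eq_or_lt with rfl | hqy
    · exact ⟨hq2, hq3⟩
    have hqR : q ∉ R := fun h => hcon q h ⟨by omega, hqy⟩
    rw [mem] at hqR
    push Not at hqR
    obtain ⟨⟨p', q'⟩, hpE, hpne, hpq, hqq⟩ := hqR ⟨by omega, by omega⟩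
    dsimp only at hpq hqq
    have h1 := hx'.2 _ hpE hpne
    have h2 := hy'.2 _ hpE hpne
    have h3 := hE.noncrossing x q p' q' hq2 hpE
    dsimp only at h1 h2
    obtain rfl : p' = x := by omega
    have := hmax q' ((memT _).2 ⟨by omega, hpE, hpne⟩)
    omega
  refine ⟨R, ⟨?_, ?_⟩, ha, hb, Finset.filter_subset _ _⟩
  · by_contra hcard
    refine (key a ha b hb (by omega) fun c hc hac => hcard ?_).2 rfl
    have hsub : ({a, c, b} : Finset ℕ) ⊆ R := by
      intro x hx
      simp only [Finset.mem_insert, Finset.mem_singleton] at hx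
      rcases hx with rfl | rfl | rfl <;> assumption
    rw [← Finset.card_eq_three.2 ⟨a, c, b, by omega, by omega, by omega, rfl⟩]
    exact Finset.card_le_card hsub
  · intro x hx y hy hxy
    constructor
    · rintro (h | h)
      · exact (key x hx y hy hxy h).1
      · have h1 := h a ha
        have h2 := h b hb
        have hx' := (mem x).1 hx
        have hy' := (mem y).1 hy
        obtain rfl : x = a := by omega
        obtain rfl : y = b := by omega
        exact hE.root
    · intro h
      by_cases hne : (x, y) = (a, b)
      · obtain ⟨rfl, rfl⟩ := Prod.mk.inj hne
        refine Or.inr fun c hc => ?_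
        have := ((mem c).1 hc).1
        omega
      · exact Or.inl fun c hc => ((mem c).1 hc).2 _ h hne

theorem isCell_three_iff {a c b : ℕ} (hac : a < c) (hcb : c < b) :
    IsCell E {a, c, b} ↔ (a, c) ∈ E ∧ (c, b) ∈ E ∧ (a, b) ∈ E := by
  have hcard : ({a, c, b} : Finset ℕ).card = 3 :=
    Finset.card_eq_three.2 ⟨a, c, b, by omega, by omega, by omega, rfl⟩
  have adj : ∀ x ∈ ({a, c, b} : Finset ℕ), ∀ y ∈ ({a, c, b} : Finset ℕ), x < y →
      Adjacent {a, c, b} x y := by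
    intro x hx y hy hxy
    simp only [Finset.mem_insert, Finset.mem_singleton] at hx hy
    simp only [Adjacent, Finset.mem_insert, Finset.mem_singleton, forall_eq_or_imp, forall_eq]
    omega
  constructor
  · rintro ⟨-, h⟩
    have h' := fun x hx y hy hxy => (h x hx y hy hxy).1 (adj x hx y hy hxy)
    exact ⟨h' a (by simp) c (by simp) hac, h' c (by simp) b (by simp) hcb,
      h' a (by simp) b (by simp) (hac.trans hcb)⟩
  · rintro ⟨h1, h2, h3⟩
    refine ⟨hcard.ge, fun x hx y hy hxy => iff_of_true (adj x hx y hy hxy) ?_⟩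
    simp only [Finset.mem_insert, Finset.mem_singleton] at hx hy
    rcases hx with rfl | rfl | rfl <;> rcases hy with rfl | rfl | rfl <;> omega

/-- In contrast to a triangle, there are non-neighbouring pairs, `(a, d)` and `(c, b)`, and these
must not be chords. -/
theorem isCell_four_iff {a c d b : ℕ} (hac : a < c) (hcd : c < d) (hdb : d < b) :
    IsCell E {a, c, d, b} ↔ ((a, c) ∈ E ∧ (c, d) ∈ E ∧ (d, b) ∈ E ∧ (a, b) ∈ E) ∧
      (a, d) ∉ E ∧ (c, b) ∉ E := by
  have hcard : ({a, c, d, b} : Finset ℕ).card = 4 :=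
    Finset.card_eq_four.2 ⟨a, c, d, b, by omega, by omega, by omega, by omega, by omega,
      by omega, rfl⟩
  have adj : ∀ x ∈ ({a, c, d, b} : Finset ℕ), ∀ y ∈ ({a, c, d, b} : Finset ℕ), x < y →
      (Adjacent {a, c, d, b} x y ↔ ¬ (x = a ∧ y = d) ∧ ¬ (x = c ∧ y = b)) := by
    intro x hx y hy hxy
    simp only [Finset.mem_insert, Finset.mem_singleton] at hx hy
    simp only [Adjacent, Finset.mem_insert, Finset.mem_singleton, forall_eq_or_imp, forall_eq]
    omega
  constructor
  · rintro ⟨-, h⟩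
    have h' := fun x hx y hy hxy => (h x hx y hy hxy).symm.trans (adj x hx y hy hxy)
    refine ⟨⟨(h' a ?_ c ?_ ?_).2 ?_, (h' c ?_ d ?_ ?_).2 ?_, (h' d ?_ b ?_ ?_).2 ?_,
      (h' a ?_ b ?_ ?_).2 ?_⟩, fun h1 => ?_, fun h1 => ?_⟩
    any_goals first | omega | simp
    · have := (h' a (by simp) d (by simp) (by omega)).1 h1
      omega
    · have := (h' c (by simp) b (by simp) (by omega)).1 h1
      omega
  · rintro ⟨⟨h1, h2, h3, h4⟩, h5, h6⟩
    refine ⟨by omega, fun x hx y hy hxy => ?_⟩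
    rw [adj x hx y hy hxy]
    simp only [Finset.mem_insert, Finset.mem_singleton] at hx hy
    rcases hx with rfl | rfl | rfl | rfl <;> rcases hy with rfl | rfl | rfl | rfl <;>
      first
        | omega
        | exact iff_of_true (by omega) ‹_›
        | exact iff_of_false (by omega) ‹_›

end EdgeSystems

/-! ### Gluing polygons onto a triangle or quadrilateral -/

section Splicing

variable {a b c d : ℕ} {E₁ E₂ E₃ : Finset (ℕ × ℕ)} {S : Finset ℕ}

/-- The edges of two polygons glued to a triangle with base `(a, b)`. -/
def spliceTri (a b : ℕ) (E₁ E₂ : Finset (ℕ × ℕ)) : Finset (ℕ × ℕ) :=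
  insert (a, b) (E₁ ∪ E₂)

/-- The edges of three polygons glued to a quadrilateral with base `(a, b)`. -/
def spliceQuad (a b : ℕ) (E₁ E₂ E₃ : Finset (ℕ × ℕ)) : Finset (ℕ × ℕ) :=
  insert (a, b) (E₁ ∪ (E₂ ∪ E₃))

theorem mem_spliceTri {i j : ℕ} :
    (i, j) ∈ spliceTri a b E₁ E₂ ↔ (i = a ∧ j = b) ∨ (i, j) ∈ E₁ ∨ (i, j) ∈ E₂ := by
  simp [spliceTri]

theorem mem_spliceQuad {i j : ℕ} : (i, j) ∈ spliceQuad a b E₁ E₂ E₃ ↔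
    (i = a ∧ j = b) ∨ (i, j) ∈ E₁ ∨ (i, j) ∈ E₂ ∨ (i, j) ∈ E₃ := by
  simp [spliceQuad]

theorem EdgeSystem.lt {E : Finset (ℕ × ℕ)} (h : EdgeSystem a b E) : a < b :=
  (h.bounds a b h.root).2.1

theorem EdgeSystem.spliceTri (h₁ : EdgeSystem a c E₁) (h₂ : EdgeSystem c b E₂) :
    EdgeSystem a b (spliceTri a b E₁ E₂) where
  bounds i j h := by
    have l₁ := h₁.lt
    have l₂ := h₂.lt
    rcases mem_spliceTri.1 h with h | h | h
    · omega
    · have := h₁.bounds i j h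
      omega
    · have := h₂.bounds i j h
      omega
  side i h h' := by
    rw [mem_spliceTri]
    rcases Nat.lt_or_ge i c with hi | hi
    · exact Or.inr (Or.inl (h₁.side i h hi))
    · exact Or.inr (Or.inr (h₂.side i hi h'))
  root := mem_spliceTri.2 (Or.inl ⟨rfl, rfl⟩)
  noncrossing i j k l h h' hik hkj := by
    have l₁ := h₁.lt
    have l₂ := h₂.lt
    rcases mem_spliceTri.1 h with h | h | h <;> rcases mem_spliceTri.1 h' with h' | h' | h' <;>
    first
      | exact h₁.noncrossing i j k l h h' hik hkj
      | exact h₂.noncrossing i j k l h h' hik hkj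
      | (try have b₁ := h₁.bounds _ _ h
         try have b₂ := h₂.bounds _ _ h
         try have b₃ := h₁.bounds _ _ h'
         try have b₄ := h₂.bounds _ _ h'
         omega)

theorem EdgeSystem.spliceQuad (h₁ : EdgeSystem a c E₁) (h₂ : EdgeSystem c d E₂)
    (h₃ : EdgeSystem d b E₃) : EdgeSystem a b (spliceQuad a b E₁ E₂ E₃) where
  bounds i j h := by
    have l₁ := h₁.lt
    have l₂ := h₂.lt
    have l₃ := h₃.lt
    rcases mem_spliceQuad.1 h with h | h | h | h
    · omega
    · have := h₁.bounds i j h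
      omega
    · have := h₂.bounds i j h
      omega
    · have := h₃.bounds i j h
      omega
  side i h h' := by
    rw [mem_spliceQuad]
    rcases Nat.lt_or_ge i c with hi | hi
    · exact Or.inr (Or.inl (h₁.side i h hi))
    · rcases Nat.lt_or_ge i d with hi' | hi'
      · exact Or.inr (Or.inr (Or.inl (h₂.side i hi hi')))
      · exact Or.inr (Or.inr (Or.inr (h₃.side i hi' h')))
  root := mem_spliceQuad.2 (Or.inl ⟨rfl, rfl⟩)
  noncrossing i j k l h h' hik hkj := by
    have l₁ := h₁.lt
    have l₂ := h₂.lt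
    have l₃ := h₃.lt
    rcases mem_spliceQuad.1 h with h | h | h | h <;>
    rcases mem_spliceQuad.1 h' with h' | h' | h' | h' <;>
    first
      | exact h₁.noncrossing i j k l h h' hik hkj
      | exact h₂.noncrossing i j k l h h' hik hkj
      | exact h₃.noncrossing i j k l h h' hik hkj
      | (try have b₁ := h₁.bounds _ _ h
         try have b₂ := h₂.bounds _ _ h
         try have b₃ := h₃.bounds _ _ h
         try have b₄ := h₁.bounds _ _ h'
         try have b₅ := h₂.bounds _ _ h'
         try have b₆ := h₃.bounds _ _ h'
         omega)

theorem within_spliceTri_left (h₁ : EdgeSystem a c E₁) (h₂ : EdgeSystem c b E₂) :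
    within (spliceTri a b E₁ E₂) a c = E₁ := by
  ext ⟨i, j⟩
  have l₂ := h₂.lt
  have b₁ := h₁.bounds i j
  have b₂ := h₂.bounds i j
  rw [mem_within, mem_spliceTri]
  grind

theorem within_spliceTri_right (h₁ : EdgeSystem a c E₁) (h₂ : EdgeSystem c b E₂) :
    within (spliceTri a b E₁ E₂) c b = E₂ := by
  ext ⟨i, j⟩
  have l₁ := h₁.lt
  have b₁ := h₁.bounds i j
  have b₂ := h₂.bounds i j
  rw [mem_within, mem_spliceTri]
  grind

theorem within_spliceQuad_left (h₁ : EdgeSystem a c E₁) (h₂ : EdgeSystem c d E₂)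
    (h₃ : EdgeSystem d b E₃) : within (spliceQuad a b E₁ E₂ E₃) a c = E₁ := by
  ext ⟨i, j⟩
  have l₂ := h₂.lt
  have l₃ := h₃.lt
  have b₁ := h₁.bounds i j
  have b₂ := h₂.bounds i j
  have b₃ := h₃.bounds i j
  rw [mem_within, mem_spliceQuad]
  grind

theorem within_spliceQuad_mid (h₁ : EdgeSystem a c E₁) (h₂ : EdgeSystem c d E₂)
    (h₃ : EdgeSystem d b E₃) : within (spliceQuad a b E₁ E₂ E₃) c d = E₂ := by
  ext ⟨i, j⟩
  have l₁ := h₁.lt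
  have l₃ := h₃.lt
  have b₁ := h₁.bounds i j
  have b₂ := h₂.bounds i j
  have b₃ := h₃.bounds i j
  rw [mem_within, mem_spliceQuad]
  grind

theorem within_spliceQuad_right (h₁ : EdgeSystem a c E₁) (h₂ : EdgeSystem c d E₂)
    (h₃ : EdgeSystem d b E₃) : within (spliceQuad a b E₁ E₂ E₃) d b = E₃ := by
  ext ⟨i, j⟩
  have l₁ := h₁.lt
  have l₂ := h₂.lt
  have b₁ := h₁.bounds i j
  have b₂ := h₂.bounds i j
  have b₃ := h₃.bounds i j
  rw [mem_within, mem_spliceQuad]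
  grind

theorem isCell_root_tri (h₁ : EdgeSystem a c E₁) (h₂ : EdgeSystem c b E₂) :
    IsCell (spliceTri a b E₁ E₂) {a, c, b} := by
  rw [isCell_three_iff h₁.lt h₂.lt, mem_spliceTri, mem_spliceTri, mem_spliceTri]
  exact ⟨Or.inr (Or.inl h₁.root), Or.inr (Or.inr h₂.root), Or.inl ⟨rfl, rfl⟩⟩

theorem isCell_root_quad (h₁ : EdgeSystem a c E₁) (h₂ : EdgeSystem c d E₂)
    (h₃ : EdgeSystem d b E₃) : IsCell (spliceQuad a b E₁ E₂ E₃) {a, c, d, b} := by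
  have l₁ := h₁.lt
  have l₂ := h₂.lt
  have l₃ := h₃.lt
  rw [isCell_four_iff l₁ l₂ l₃]
  simp only [mem_spliceQuad]
  refine ⟨⟨Or.inr (Or.inl h₁.root), Or.inr (Or.inr (Or.inl h₂.root)),
    Or.inr (Or.inr (Or.inr h₃.root)), by simp⟩, ?_, ?_⟩
  · rintro (h | h | h | h)
    · omega
    · have := h₁.bounds _ _ h
      omega
    · have := h₂.bounds _ _ h
      omega
    · have := h₃.bounds _ _ h
      omega
  · rintro (h | h | h | h)
    · omega
    · have := h₁.bounds _ _ h
      omega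
    · have := h₂.bounds _ _ h
      omega
    · have := h₃.bounds _ _ h
      omega

theorem insert_three_subset_Icc (hac : a ≤ c) (hcb : c ≤ b) :
    ({a, c, b} : Finset ℕ) ⊆ Finset.Icc a b := by
  intro x hx
  simp only [Finset.mem_insert, Finset.mem_singleton, Finset.mem_Icc] at hx ⊢
  omega

theorem insert_four_subset_Icc (hac : a ≤ c) (hcd : c ≤ d) (hdb : d ≤ b) :
    ({a, c, d, b} : Finset ℕ) ⊆ Finset.Icc a b := by
  intro x hx
  simp only [Finset.mem_insert, Finset.mem_singleton, Finset.mem_Icc] at hx ⊢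
  omega

theorem isCell_of_within {E E' : Finset (ℕ × ℕ)} {x y : ℕ} (hE : within E x y = E')
    (h' : EdgeSystem x y E') (h : IsCell E' S) : IsCell E S := by
  have := h'.subset_Icc h
  rw [← hE] at h
  exact (isCell_within this).1 h

theorem IsCell.of_base_mem {E E' : Finset (ℕ × ℕ)} {x y i j : ℕ} (hE : within E x y = E')
    (h' : EdgeSystem x y E') (hij : (i, j) ∈ E') (hS : S ⊆ Finset.Icc i j) (h : IsCell E S) :
    IsCell E' S := by
  have := h'.bounds i j hij
  rw [← hE]
  exact (isCell_within (hS.trans (Finset.Icc_subset_Icc this.1 this.2.2))).2 h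

/-- The base of a cell decides: over `(a, b)` the cell is the root triangle by uniqueness, and over
a chord of one part the whole cell lies in that part. -/
theorem isCell_spliceTri (h₁ : EdgeSystem a c E₁) (h₂ : EdgeSystem c b E₂) :
    IsCell (spliceTri a b E₁ E₂) S ↔ S = {a, c, b} ∨ IsCell E₁ S ∨ IsCell E₂ S := by
  constructor
  · intro h
    obtain ⟨i, j, hi, hj, hS, -, hij⟩ := h.exists_base
    rcases mem_spliceTri.1 hij with ⟨rfl, rfl⟩ | hij | hij
    · exact Or.inl ((h₁.spliceTri h₂).cell_unique h (isCell_root_tri h₁ h₂) hi hj (by simp)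
        (by simp) hS (insert_three_subset_Icc h₁.lt.le h₂.lt.le))
    · exact Or.inr (Or.inl (h.of_base_mem (within_spliceTri_left h₁ h₂) h₁ hij hS))
    · exact Or.inr (Or.inr (h.of_base_mem (within_spliceTri_right h₁ h₂) h₂ hij hS))
  · rintro (rfl | h | h)
    · exact isCell_root_tri h₁ h₂
    · exact isCell_of_within (within_spliceTri_left h₁ h₂) h₁ h
    · exact isCell_of_within (within_spliceTri_right h₁ h₂) h₂ h

theorem isCell_spliceQuad (h₁ : EdgeSystem a c E₁) (h₂ : EdgeSystem c d E₂)
    (h₃ : EdgeSystem d b E₃) : IsCell (spliceQuad a b E₁ E₂ E₃) S ↔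
      S = {a, c, d, b} ∨ IsCell E₁ S ∨ IsCell E₂ S ∨ IsCell E₃ S := by
  constructor
  · intro h
    obtain ⟨i, j, hi, hj, hS, -, hij⟩ := h.exists_base
    rcases mem_spliceQuad.1 hij with ⟨rfl, rfl⟩ | hij | hij | hij
    · exact Or.inl ((h₁.spliceQuad h₂ h₃).cell_unique h (isCell_root_quad h₁ h₂ h₃) hi hj
        (by simp) (by simp) hS (insert_four_subset_Icc h₁.lt.le h₂.lt.le h₃.lt.le))
    · exact Or.inr (Or.inl (h.of_base_mem (within_spliceQuad_left h₁ h₂ h₃) h₁ hij hS))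
    · exact Or.inr (Or.inr (Or.inl
        (h.of_base_mem (within_spliceQuad_mid h₁ h₂ h₃) h₂ hij hS)))
    · exact Or.inr (Or.inr (Or.inr
        (h.of_base_mem (within_spliceQuad_right h₁ h₂ h₃) h₃ hij hS)))
  · rintro (rfl | h | h | h)
    · exact isCell_root_quad h₁ h₂ h₃
    · exact isCell_of_within (within_spliceQuad_left h₁ h₂ h₃) h₁ h
    · exact isCell_of_within (within_spliceQuad_mid h₁ h₂ h₃) h₂ h
    · exact isCell_of_within (within_spliceQuad_right h₁ h₂ h₃) h₃ h

end Splicing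

/-! ### Cutting a dissection along its root region -/

section Decomposition

variable {a b c d : ℕ} {E : Finset (ℕ × ℕ)} {S : Finset ℕ}

theorem EdgeSystem.right_unique {b' : ℕ} (h : EdgeSystem a b E) (h' : EdgeSystem a b' E) :
    b = b' :=
  le_antisymm (h'.bounds _ _ h.root).2.2 (h.bounds _ _ h'.root).2.2

theorem EdgeSystem.eq_spliceTri (hE : EdgeSystem a b E) (h₁ : (a, c) ∈ E) (h₂ : (c, b) ∈ E) :
    PatternParking.spliceTri a b (PatternParking.within E a c) (PatternParking.within E c b) = E := by
  ext ⟨x, y⟩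
  rw [mem_spliceTri, mem_within, mem_within]
  constructor
  · rintro (⟨rfl, rfl⟩ | h | h)
    · exact hE.root
    · exact h.1
    · exact h.1
  · intro h
    have b₀ := hE.bounds _ _ h
    have n₁ := hE.noncrossing _ _ _ _ h₁ h
    have n₂ := hE.noncrossing _ _ _ _ h h₂
    by_cases hy : y ≤ c
    · exact Or.inr (Or.inl ⟨h, b₀.1, hy⟩)
    by_cases hx : c ≤ x
    · exact Or.inr (Or.inr ⟨h, hx, b₀.2.2⟩)
    exact Or.inl (by omega)

/-- By non-crossing, a chord below none of the three inner edges can only be the base or a diagonal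
of the quadrilateral; the last two hypotheses exclude the diagonals. -/
theorem EdgeSystem.eq_spliceQuad (hE : EdgeSystem a b E) (h₁ : (a, c) ∈ E) (h₂ : (c, d) ∈ E)
    (h₃ : (d, b) ∈ E) (h₄ : (a, d) ∉ E) (h₅ : (c, b) ∉ E) :
    PatternParking.spliceQuad a b (PatternParking.within E a c) (PatternParking.within E c d)
      (PatternParking.within E d b) = E := by
  ext ⟨x, y⟩
  rw [mem_spliceQuad, mem_within, mem_within, mem_within]
  constructor
  · rintro (⟨rfl, rfl⟩ | h | h | h)
    · exact hE.root
    · exact h.1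
    · exact h.1
    · exact h.1
  · intro h
    have b₀ := hE.bounds _ _ h
    have b₂ := hE.bounds _ _ h₂
    have n₁ := hE.noncrossing _ _ _ _ h₁ h
    have n₂ := hE.noncrossing _ _ _ _ h h₂
    have n₃ := hE.noncrossing _ _ _ _ h₂ h
    have n₄ := hE.noncrossing _ _ _ _ h h₃
    have m₁ : ¬ (x = a ∧ y = d) := by
      rintro ⟨rfl, rfl⟩
      exact h₄ h
    have m₂ : ¬ (x = c ∧ y = b) := by
      rintro ⟨rfl, rfl⟩
      exact h₅ h
    by_cases hy : y ≤ c
    · exact Or.inr (Or.inl ⟨h, b₀.1, hy⟩)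
    by_cases hx : d ≤ x
    · exact Or.inr (Or.inr (Or.inr ⟨h, hx, b₀.2.2⟩))
    by_cases hm : c ≤ x ∧ y ≤ d
    · exact Or.inr (Or.inr (Or.inl ⟨h, hm⟩))
    exact Or.inl (by omega)

theorem eq_insert_of_card_three (ha : a ∈ S) (hb : b ∈ S) (hab : a < b)
    (hS : S ⊆ Finset.Icc a b) (hcard : S.card = 3) : ∃ c, a < c ∧ c < b ∧ S = {a, c, b} := by
  have h1 : ((S.erase a).erase b).card = 1 := by
    rw [Finset.card_erase_of_mem (Finset.mem_erase.2 ⟨hab.ne', hb⟩), Finset.card_erase_of_mem ha,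
      hcard]
  obtain ⟨c, hc⟩ := Finset.card_eq_one.1 h1
  have mem : ∀ x, x ≠ b ∧ x ≠ a ∧ x ∈ S ↔ x = c := fun x => by
    rw [← Finset.mem_erase, ← Finset.mem_erase, hc, Finset.mem_singleton]
  have hc' := (mem c).2 rfl
  have hc'' := Finset.mem_Icc.1 (hS hc'.2.2)
  refine ⟨c, by omega, by omega, ?_⟩
  ext x
  simp only [Finset.mem_insert, Finset.mem_singleton]
  rw [← mem x]
  constructor
  · intro hx
    by_cases x = a <;> by_cases x = b <;> simp_all
  · rintro (rfl | h | rfl)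
    · exact ha
    · exact h.2.2
    · exact hb

theorem eq_insert_of_card_four (ha : a ∈ S) (hb : b ∈ S) (hab : a < b)
    (hS : S ⊆ Finset.Icc a b) (hcard : S.card = 4) :
    ∃ c d, a < c ∧ c < d ∧ d < b ∧ S = {a, c, d, b} := by
  have h1 : ((S.erase a).erase b).card = 2 := by
    rw [Finset.card_erase_of_mem (Finset.mem_erase.2 ⟨hab.ne', hb⟩), Finset.card_erase_of_mem ha,
      hcard]
  obtain ⟨c, d, hcd, hc⟩ : ∃ c d, c < d ∧ (S.erase a).erase b = {c, d} := by
    obtain ⟨c, d, hne, h⟩ := Finset.card_eq_two.1 h1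
    rcases hne.lt_or_gt with hlt | hlt
    · exact ⟨c, d, hlt, h⟩
    · exact ⟨d, c, hlt, h.trans (Finset.pair_comm c d)⟩
  have mem : ∀ x, x ≠ b ∧ x ≠ a ∧ x ∈ S ↔ x = c ∨ x = d := fun x => by
    rw [← Finset.mem_erase, ← Finset.mem_erase, hc, Finset.mem_insert, Finset.mem_singleton]
  have hc' := (mem c).2 (Or.inl rfl)
  have hd' := (mem d).2 (Or.inr rfl)
  have hc'' := Finset.mem_Icc.1 (hS hc'.2.2)
  have hd'' := Finset.mem_Icc.1 (hS hd'.2.2)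
  refine ⟨c, d, by omega, by omega, by omega, ?_⟩
  ext x
  simp only [Finset.mem_insert, Finset.mem_singleton]
  have hx := mem x
  constructor
  · intro hxS
    by_cases x = a <;> by_cases x = b <;> simp_all
  · rintro (rfl | rfl | rfl | rfl)
    · exact ha
    · exact hc'.2.2
    · exact hd'.2.2
    · exact hb

end Decomposition

/-! ### The duality between trees and dissections -/

namespace BTTree

/-- The edges of the dissection dual to `t` of a polygon whose first vertex is `a`. -/
def edges : BTTree → ℕ → Finset (ℕ × ℕ)
  | leaf, a => {(a, a + 1)}
  | tri l r, a => spliceTri a (a + l.leaves + r.leaves) (l.edges a) (r.edges (a + l.leaves))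
  | quad l c r, a => spliceQuad a (a + l.leaves + c.leaves + r.leaves) (l.edges a)
      (c.edges (a + l.leaves)) (r.edges (a + l.leaves + c.leaves))

/-- The regions of the dissection dual to `t` of a polygon whose first vertex is `a`. -/
def cells : BTTree → ℕ → Finset (Finset ℕ)
  | leaf, _ => ∅
  | tri l r, a => insert {a, a + l.leaves, a + l.leaves + r.leaves}
      (l.cells a ∪ r.cells (a + l.leaves))
  | quad l c r, a =>
      insert {a, a + l.leaves, a + l.leaves + c.leaves, a + l.leaves + c.leaves + r.leaves}
        (l.cells a ∪ (c.cells (a + l.leaves) ∪ r.cells (a + l.leaves + c.leaves)))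

theorem edgeSystem_edges (t : BTTree) (a : ℕ) : EdgeSystem a (a + t.leaves) (t.edges a) := by
  induction t generalizing a with
  | leaf =>
    simp only [leaves, edges]
    refine ⟨?_, ?_, ?_, ?_⟩
    · intro i j h
      simp at h
      omega
    · intro i h h'
      simp
      omega
    · simp
    · intro i j k l h h'
      simp at h h'
      omega
  | tri l r ihl ihr =>
    simp only [leaves, edges, ← add_assoc]
    exact (ihl a).spliceTri (ihr _)
  | quad l c r ihl ihc ihr =>
    simp only [leaves, edges, ← add_assoc]
    exact (ihl a).spliceQuad (ihc _) (ihr _)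

theorem mem_cells {t : BTTree} {a : ℕ} {S : Finset ℕ} :
    S ∈ t.cells a ↔ IsCell (t.edges a) S := by
  induction t generalizing a with
  | leaf =>
    simp only [cells, edges, Finset.notMem_empty, false_iff]
    intro h
    obtain ⟨i, j, -, -, -, hij, h'⟩ := h.exists_base
    simp at h'
    omega
  | tri l r ihl ihr =>
    simp only [cells, edges, Finset.mem_insert, Finset.mem_union, ihl, ihr]
    rw [isCell_spliceTri (l.edgeSystem_edges a) (r.edgeSystem_edges _)]
  | quad l c r ihl ihc ihr =>
    simp only [cells, edges, Finset.mem_insert, Finset.mem_union, ihl, ihc, ihr]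
    rw [isCell_spliceQuad (l.edgeSystem_edges a) (c.edgeSystem_edges _) (r.edgeSystem_edges _)]

theorem subset_Icc_of_mem_cells {t : BTTree} {a : ℕ} {S : Finset ℕ} (h : S ∈ t.cells a) :
    S ⊆ Finset.Icc a (a + t.leaves) :=
  (t.edgeSystem_edges a).subset_Icc (mem_cells.1 h)

/-- The vertex ranges share at most the point `b`, whereas a cell has at least three vertices. -/
theorem disjoint_cells {s t : BTTree} {a b : ℕ} (hab : a + s.leaves ≤ b) :
    Disjoint (s.cells a) (t.cells b) := by
  rw [Finset.disjoint_left]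
  intro S hs ht
  have h3 := (mem_cells.1 hs).1
  have hsub : S ⊆ {b} := fun x hx => by
    have h1 := Finset.mem_Icc.1 (subset_Icc_of_mem_cells hs hx)
    have h2 := Finset.mem_Icc.1 (subset_Icc_of_mem_cells ht hx)
    rw [Finset.mem_singleton]
    omega
  have := Finset.card_le_card hsub
  simp at this
  omega

theorem card_three {a c b : ℕ} (hac : a < c) (hcb : c < b) : ({a, c, b} : Finset ℕ).card = 3 :=
  Finset.card_eq_three.2 ⟨a, c, b, by omega, by omega, by omega, rfl⟩

theorem card_four {a c d b : ℕ} (hac : a < c) (hcd : c < d) (hdb : d < b) :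
    ({a, c, d, b} : Finset ℕ).card = 4 :=
  Finset.card_eq_four.2 ⟨a, c, d, b, by omega, by omega, by omega, by omega, by omega,
    by omega, rfl⟩

theorem card_of_mem_cells {t : BTTree} {a : ℕ} {S : Finset ℕ} (h : S ∈ t.cells a) :
    S.card = 3 ∨ S.card = 4 := by
  induction t generalizing a with
  | leaf => simp [cells] at h
  | tri l r ihl ihr =>
    have p₁ := l.leaves_pos
    have p₂ := r.leaves_pos
    simp only [cells, Finset.mem_insert, Finset.mem_union] at h
    rcases h with rfl | h | h
    · exact Or.inl (card_three (by omega) (by omega))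
    · exact ihl h
    · exact ihr h
  | quad l c r ihl ihc ihr =>
    have p₁ := l.leaves_pos
    have p₂ := c.leaves_pos
    have p₃ := r.leaves_pos
    simp only [cells, Finset.mem_insert, Finset.mem_union] at h
    rcases h with rfl | h | h | h
    · exact Or.inr (card_four (by omega) (by omega) (by omega))
    · exact ihl h
    · exact ihc h
    · exact ihr h

theorem card_filter_cells (t : BTTree) (a : ℕ) :
    ((t.cells a).filter fun S => S.card = 4).card = t.quads := by
  induction t generalizing a with
  | leaf => simp [cells, quads]
  | tri l r ihl ihr =>
    have p₁ := l.leaves_pos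
    have p₂ := r.leaves_pos
    have h3 := card_three (show a < a + l.leaves by omega)
      (show a + l.leaves < a + l.leaves + r.leaves by omega)
    simp only [cells, quads]
    rw [Finset.filter_insert, if_neg (by omega), Finset.filter_union,
      Finset.card_union_of_disjoint (Finset.disjoint_filter_filter (disjoint_cells le_rfl)),
      ihl, ihr]
  | quad l c r ihl ihc ihr =>
    have p₁ := l.leaves_pos
    have p₂ := c.leaves_pos
    have p₃ := r.leaves_pos
    have h4 := card_four (show a < a + l.leaves by omega)
      (show a + l.leaves < a + l.leaves + c.leaves by omega)
      (show a + l.leaves + c.leaves < a + l.leaves + c.leaves + r.leaves by omega)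
    simp only [cells, quads]
    rw [Finset.filter_insert, if_pos h4, Finset.card_insert_of_notMem, Finset.filter_union,
      Finset.card_union_of_disjoint, Finset.filter_union,
      Finset.card_union_of_disjoint (Finset.disjoint_filter_filter (disjoint_cells le_rfl)),
      ihl, ihc, ihr]
    · omega
    · refine Finset.disjoint_filter_filter ?_
      rw [Finset.disjoint_union_right]
      exact ⟨disjoint_cells le_rfl, disjoint_cells (by omega)⟩
    · intro h
      simp only [Finset.mem_filter, Finset.mem_union] at h
      rcases h.1 with h | h | h
      · have := Finset.mem_Icc.1 (subset_Icc_of_mem_cells h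
          (show a + l.leaves + c.leaves ∈ _ by simp))
        omega
      · have := Finset.mem_Icc.1 (subset_Icc_of_mem_cells h (show a ∈ _ by simp))
        omega
      · have := Finset.mem_Icc.1 (subset_Icc_of_mem_cells h (show a ∈ _ by simp))
        omega

/-- The edge set determines the root cell, whose vertices reveal the root's arity and the leaf
counts of its subtrees; restricting to the chords below recovers each subtree. -/
theorem edges_injective {t t' : BTTree} {a : ℕ} (h : t.edges a = t'.edges a) : t = t' := by
  induction t generalizing t' a with
  | leaf =>
    have hb := (edgeSystem_edges leaf a).right_unique (h ▸ edgeSystem_edges t' a)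
    cases t' with
    | leaf => rfl
    | tri l r =>
      have p₁ := l.leaves_pos
      have p₂ := r.leaves_pos
      simp only [leaves] at hb
      omega
    | quad l c r =>
      have p₁ := l.leaves_pos
      have p₂ := c.leaves_pos
      have p₃ := r.leaves_pos
      simp only [leaves] at hb
      omega
  | tri l r ihl ihr =>
    have hb := (edgeSystem_edges (tri l r) a).right_unique (h ▸ edgeSystem_edges t' a)
    have s₁ := l.edgeSystem_edges a
    have s₂ := r.edgeSystem_edges (a + l.leaves)
    have hc := isCell_root_tri s₁ s₂
    have l₁ := s₁.lt
    have l₂ := s₂.lt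
    cases t' with
    | leaf =>
      simp only [leaves] at hb
      omega
    | tri l' r' =>
      have s₁' := l'.edgeSystem_edges a
      have s₂' := r'.edgeSystem_edges (a + l'.leaves)
      have hc' := isCell_root_tri s₁' s₂'
      have l₁' := s₁'.lt
      have l₂' := s₂'.lt
      have hb' : a + l.leaves + r.leaves = a + l'.leaves + r'.leaves := by
        simp only [leaves] at hb
        omega
      simp only [edges] at h
      rw [h] at hc
      rw [hb'] at hc
      have hS := (s₁'.spliceTri s₂').cell_unique hc hc' (i := a)
        (j := a + l'.leaves + r'.leaves) (by simp) (by simp) (by simp) (by simp)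
        (insert_three_subset_Icc (by omega) (by omega))
        (insert_three_subset_Icc (by omega) (by omega))
      have hm : a + l.leaves ∈ ({a, a + l'.leaves, a + l'.leaves + r'.leaves} : Finset ℕ) := by
        rw [← hS]
        simp
      have hl : l.leaves = l'.leaves := by
        simp only [Finset.mem_insert, Finset.mem_singleton] at hm
        omega
      have e₁ := within_spliceTri_left s₁ s₂
      have e₂ := within_spliceTri_right s₁ s₂
      rw [h, hl, within_spliceTri_left s₁' s₂'] at e₁
      rw [h, hb', hl, within_spliceTri_right s₁' s₂'] at e₂
      rw [ihl e₁.symm, ihr e₂.symm]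
    | quad l' c' r' =>
      exfalso
      have s₁' := l'.edgeSystem_edges a
      have s₂' := c'.edgeSystem_edges (a + l'.leaves)
      have s₃' := r'.edgeSystem_edges (a + l'.leaves + c'.leaves)
      have hc' := isCell_root_quad s₁' s₂' s₃'
      have l₁' := s₁'.lt
      have l₂' := s₂'.lt
      have l₃' := s₃'.lt
      have hb' : a + l.leaves + r.leaves = a + l'.leaves + c'.leaves + r'.leaves := by
        simp only [leaves] at hb
        omega
      simp only [edges] at h
      rw [h] at hc
      have hS := (s₁'.spliceQuad s₂' s₃').cell_unique hc hc' (i := a)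
        (j := a + l.leaves + r.leaves) (by simp) (by simp) (by simp) (by simp [hb'])
        (insert_three_subset_Icc (by omega) (by omega))
        (hb' ▸ insert_four_subset_Icc (by omega) (by omega) (by omega))
      have := congrArg Finset.card hS
      rw [card_three l₁ l₂, card_four l₁' l₂' l₃'] at this
      omega
  | quad l c r ihl ihc ihr =>
    have hb := (edgeSystem_edges (quad l c r) a).right_unique (h ▸ edgeSystem_edges t' a)
    have s₁ := l.edgeSystem_edges a
    have s₂ := c.edgeSystem_edges (a + l.leaves)
    have s₃ := r.edgeSystem_edges (a + l.leaves + c.leaves)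
    have hc := isCell_root_quad s₁ s₂ s₃
    have l₁ := s₁.lt
    have l₂ := s₂.lt
    have l₃ := s₃.lt
    cases t' with
    | leaf =>
      simp only [leaves] at hb
      omega
    | tri l' r' =>
      exfalso
      have s₁' := l'.edgeSystem_edges a
      have s₂' := r'.edgeSystem_edges (a + l'.leaves)
      have hc' := isCell_root_tri s₁' s₂'
      have l₁' := s₁'.lt
      have l₂' := s₂'.lt
      have hb' : a + l.leaves + c.leaves + r.leaves = a + l'.leaves + r'.leaves := by
        simp only [leaves] at hb
        omega
      simp only [edges] at h
      rw [h] at hc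
      have hS := (s₁'.spliceTri s₂').cell_unique hc hc' (i := a)
        (j := a + l.leaves + c.leaves + r.leaves) (by simp) (by simp) (by simp) (by simp [hb'])
        (insert_four_subset_Icc (by omega) (by omega) (by omega))
        (hb' ▸ insert_three_subset_Icc (by omega) (by omega))
      have := congrArg Finset.card hS
      rw [card_three l₁' l₂', card_four l₁ l₂ l₃] at this
      omega
    | quad l' c' r' =>
      have s₁' := l'.edgeSystem_edges a
      have s₂' := c'.edgeSystem_edges (a + l'.leaves)
      have s₃' := r'.edgeSystem_edges (a + l'.leaves + c'.leaves)
      have hc' := isCell_root_quad s₁' s₂' s₃'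
      have l₁' := s₁'.lt
      have l₂' := s₂'.lt
      have l₃' := s₃'.lt
      have hb' : a + l.leaves + c.leaves + r.leaves =
          a + l'.leaves + c'.leaves + r'.leaves := by
        simp only [leaves] at hb
        omega
      simp only [edges] at h
      rw [h, hb'] at hc
      have hS := (s₁'.spliceQuad s₂' s₃').cell_unique hc hc' (i := a)
        (j := a + l'.leaves + c'.leaves + r'.leaves) (by simp) (by simp) (by simp) (by simp)
        (insert_four_subset_Icc (by omega) (by omega) (by omega))
        (insert_four_subset_Icc (by omega) (by omega) (by omega))
      have hm : a + l.leaves ∈ ({a, a + l'.leaves, a + l'.leaves + c'.leaves,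
          a + l'.leaves + c'.leaves + r'.leaves} : Finset ℕ) := by
        rw [← hS]
        simp
      have hm' : a + l.leaves + c.leaves ∈ ({a, a + l'.leaves, a + l'.leaves + c'.leaves,
          a + l'.leaves + c'.leaves + r'.leaves} : Finset ℕ) := by
        rw [← hS]
        simp
      have hm'' : a + l'.leaves ∈ ({a, a + l.leaves, a + l.leaves + c.leaves,
          a + l'.leaves + c'.leaves + r'.leaves} : Finset ℕ) := by
        rw [hS]
        simp
      simp only [Finset.mem_insert, Finset.mem_singleton] at hm hm' hm''
      have hl : l.leaves = l'.leaves := by omega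
      have hc : c.leaves = c'.leaves := by omega
      have e₁ := within_spliceQuad_left s₁ s₂ s₃
      have e₂ := within_spliceQuad_mid s₁ s₂ s₃
      have e₃ := within_spliceQuad_right s₁ s₂ s₃
      rw [h, hl, within_spliceQuad_left s₁' s₂' s₃'] at e₁
      rw [h, hl, hc, within_spliceQuad_mid s₁' s₂' s₃'] at e₂
      rw [h, hb', hl, hc, within_spliceQuad_right s₁' s₂' s₃'] at e₃
      rw [ihl e₁.symm, ihc e₂.symm, ihr e₃.symm]

/-- The region at the base becomes the root, and the polygons cut off by its other edges become the
subtrees. A polygon reduced to one edge is a leaf. -/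
theorem exists_edges_eq {a b : ℕ} {E : Finset (ℕ × ℕ)} (hE : EdgeSystem a b E)
    (h : ∀ S, IsCell E S → S.card = 3 ∨ S.card = 4) :
    ∃ t : BTTree, a + t.leaves = b ∧ t.edges a = E := by
  induction hm : b - a using Nat.strong_induction_on generalizing a b E with
  | _ m ih =>
    subst hm
    have hab := hE.lt
    have sub : ∀ x y, (x, y) ∈ E → y - x < b - a →
        ∃ t : BTTree, x + t.leaves = y ∧ t.edges x = within E x y := by
      intro x y hxy hlt
      refine ih _ hlt (hE.within hxy) (fun S hS => h S ?_) rfl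
      exact (isCell_within ((hE.within hxy).subset_Icc hS)).1 hS
    rcases Nat.lt_or_ge b (a + 2) with hb | hb
    · obtain rfl : b = a + 1 := by omega
      refine ⟨leaf, rfl, ?_⟩
      ext ⟨x, y⟩
      simp only [edges, Finset.mem_singleton, Prod.mk.injEq]
      constructor
      · rintro ⟨rfl, rfl⟩
        exact hE.root
      · intro hxy
        have := hE.bounds x y hxy
        omega
    · obtain ⟨S, hS, haS, hbS, hsub⟩ := hE.exists_cell hb
      rcases h S hS with h3 | h4
      · obtain ⟨c, hac, hcb, rfl⟩ := eq_insert_of_card_three haS hbS hab hsub h3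
        obtain ⟨e₁, e₂, -⟩ := (isCell_three_iff hac hcb).1 hS
        obtain ⟨l, rfl, hl⟩ := sub a c e₁ (by omega)
        obtain ⟨r, rfl, hr⟩ := sub _ b e₂ (by omega)
        refine ⟨tri l r, by simp only [leaves, ← add_assoc], ?_⟩
        rw [edges, hl, hr, hE.eq_spliceTri e₁ e₂]
      · obtain ⟨c, d, hac, hcd, hdb, rfl⟩ := eq_insert_of_card_four haS hbS hab hsub h4
        obtain ⟨⟨e₁, e₂, e₃, -⟩, e₄, e₅⟩ := (isCell_four_iff hac hcd hdb).1 hS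
        obtain ⟨l, rfl, hl⟩ := sub a c e₁ (by omega)
        obtain ⟨c, rfl, hc⟩ := sub _ d e₂ (by omega)
        obtain ⟨r, rfl, hr⟩ := sub _ b e₃ (by omega)
        refine ⟨quad l c r, by simp only [leaves, ← add_assoc], ?_⟩
        rw [edges, hl, hc, hr, hE.eq_spliceQuad e₁ e₂ e₃ e₄ e₅]

end BTTree

/-! ### Transfer from chord systems on `ℕ` to `Dissection` -/

section Dissections

variable {n : ℕ}

/-- The sides and the diagonals of a dissection of the polygon with vertices `0, …, n + 1`. -/
def Dissection.edges (D : Dissection (n + 2)) : Finset (ℕ × ℕ) :=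
  insert (0, n + 1) (D.diagonals.image (fun d => ((d.1 : ℕ), (d.2 : ℕ))) ∪
    (Finset.range (n + 1)).image fun i => (i, i + 1))

theorem Dissection.mem_edges {D : Dissection (n + 2)} {i j : ℕ} :
    (i, j) ∈ D.edges ↔ (i = 0 ∧ j = n + 1) ∨
      (∃ d ∈ D.diagonals, (d.1 : ℕ) = i ∧ (d.2 : ℕ) = j) ∨ (i < n + 1 ∧ j = i + 1) := by
  simp only [Dissection.edges, Finset.mem_insert, Finset.mem_union, Finset.mem_image,
    Prod.mk.injEq, Finset.mem_range]
  refine or_congr_right (or_congr_right ⟨?_, ?_⟩)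
  · rintro ⟨a, h, rfl, rfl⟩
    exact ⟨h, rfl⟩
  · rintro ⟨h, rfl⟩
    exact ⟨i, h, rfl, rfl⟩

theorem Dissection.mem_edges_iff (D : Dissection (n + 2)) {a b : Fin (n + 2)} :
    ((a : ℕ), (b : ℕ)) ∈ D.edges ↔ IsSide a b ∨ (a, b) ∈ D.diagonals := by
  have ha := a.2
  have hb := b.2
  have hd : (∃ d ∈ D.diagonals, (d.1 : ℕ) = a ∧ (d.2 : ℕ) = b) ↔ (a, b) ∈ D.diagonals := by
    constructor
    · rintro ⟨⟨x, y⟩, h, h1, h2⟩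
      obtain rfl := Fin.ext h1
      obtain rfl := Fin.ext h2
      exact h
    · intro h
      exact ⟨_, h, rfl, rfl⟩
  rw [Dissection.mem_edges, hd, IsSide]
  constructor
  · rintro (h | h | h)
    · exact Or.inl (Or.inr (by omega))
    · exact Or.inr h
    · exact Or.inl (Or.inl (by omega))
  · rintro ((h | h) | h)
    · exact Or.inr (Or.inr (by omega))
    · exact Or.inl (by omega)
    · exact Or.inr (Or.inl h)

theorem Dissection.edgeSystem (D : Dissection (n + 2)) : EdgeSystem 0 (n + 1) D.edges where
  bounds i j h := by
    rcases Dissection.mem_edges.1 h with h | ⟨d, hd, rfl, rfl⟩ | h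
    · omega
    · have := Fin.lt_def.1 (D.isDiagonal d hd).1
      have := d.2.2
      omega
    · omega
  side i _ h := Dissection.mem_edges.2 (Or.inr (Or.inr ⟨h, rfl⟩))
  root := Dissection.mem_edges.2 (Or.inl ⟨rfl, rfl⟩)
  noncrossing i j k l h h' hik hkj := by
    rcases Dissection.mem_edges.1 h with h | ⟨d, hd, rfl, rfl⟩ | h
    · rcases Dissection.mem_edges.1 h' with h' | ⟨e, he, rfl, rfl⟩ | h'
      · omega
      · have := e.2.2
        omega
      · omega
    · rcases Dissection.mem_edges.1 h' with h' | ⟨e, he, rfl, rfl⟩ | h'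
      · omega
      · by_contra hlt
        exact D.noncrossing d hd e he ⟨hik, hkj, Fin.lt_def.2 (not_le.1 hlt)⟩
      · omega
    · omega

/-- Adding the sides loses nothing, since no stored diagonal is a side. -/
theorem Dissection.edges_injective {D D' : Dissection (n + 2)} (h : D.edges = D'.edges) :
    D = D' := by
  have key : ∀ {D D' : Dissection (n + 2)}, D.edges = D'.edges → D.diagonals ⊆ D'.diagonals := by
    rintro D D' h ⟨a, b⟩ hab
    have h1 := (D.mem_edges_iff).2 (Or.inr hab)
    rw [h] at h1
    exact ((D'.mem_edges_iff).1 h1).resolve_left (D.isDiagonal _ hab).2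
  have hd := (key h).antisymm (key h.symm)
  obtain ⟨d, h1, h2⟩ := D
  obtain ⟨d', h1', h2'⟩ := D'
  obtain rfl : d = d' := hd
  rfl

theorem Dissection.isRegion_iff (D : Dissection (n + 2)) (S : Finset (Fin (n + 2))) :
    D.IsRegion S ↔ IsCell D.edges (S.map Fin.valEmbedding) := by
  simp only [Dissection.IsRegion, IsCell, Finset.card_map, Finset.forall_mem_map,
    Fin.valEmbedding_apply, D.mem_edges_iff, Adjacent, Neighbours, Fin.lt_def]

theorem exists_map_eq {S : Finset ℕ} (h : S ⊆ Finset.Icc 0 (n + 1)) :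
    ∃ S' : Finset (Fin (n + 2)), S'.map Fin.valEmbedding = S := by
  refine ⟨S.attachFin fun m hm => ?_, ?_⟩
  · have := Finset.mem_Icc.1 (h hm)
    omega
  · ext x
    simp only [Finset.mem_map, Finset.mem_attachFin, Fin.valEmbedding_apply]
    constructor
    · rintro ⟨a, ha, rfl⟩
      exact ha
    · intro hx
      have := Finset.mem_Icc.1 (h hx)
      exact ⟨⟨x, by omega⟩, hx, rfl⟩

theorem Dissection.forall_isRegion_iff (D : Dissection (n + 2)) :
    (∀ S, D.IsRegion S → S.card = 3 ∨ S.card = 4) ↔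
      ∀ S, IsCell D.edges S → S.card = 3 ∨ S.card = 4 := by
  constructor
  · intro h S hS
    obtain ⟨S', rfl⟩ := exists_map_eq (D.edgeSystem.subset_Icc hS)
    rw [Finset.card_map]
    exact h S' ((D.isRegion_iff S').2 hS)
  · intro h S hS
    have := h _ ((D.isRegion_iff S).1 hS)
    rwa [Finset.card_map] at this

theorem Dissection.quadrilaterals_eq (D : Dissection (n + 2)) :
    D.quadrilaterals = {S : Finset ℕ | IsCell D.edges S ∧ S.card = 4}.ncard := by
  rw [Dissection.quadrilaterals, ← Set.ncard_image_of_injective _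
    (Finset.map_injective (Fin.valEmbedding (n := n + 2)))]
  congr 1
  ext S
  constructor
  · rintro ⟨S, ⟨h1, h2⟩, rfl⟩
    exact ⟨(D.isRegion_iff S).1 h1, by rw [Finset.card_map, h2]⟩
  · rintro ⟨h1, h2⟩
    obtain ⟨S', rfl⟩ := exists_map_eq (D.edgeSystem.subset_Icc h1)
    rw [Finset.card_map] at h2
    exact ⟨S', ⟨(D.isRegion_iff S').2 h1, h2⟩, rfl⟩

theorem Dissection.quadrilaterals_eq_quads {D : Dissection (n + 2)} {t : BTTree}
    (h : t.edges 0 = D.edges) : D.quadrilaterals = t.quads := by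
  rw [D.quadrilaterals_eq, ← t.card_filter_cells 0, ← Set.ncard_coe_finset]
  congr 1
  ext S
  simp [BTTree.mem_cells, h]

open Classical in
theorem EdgeSystem.exists_dissection {E : Finset (ℕ × ℕ)} (hE : EdgeSystem 0 (n + 1) E) :
    ∃ D : Dissection (n + 2), D.edges = E := by
  let D : Dissection (n + 2) :=
    { diagonals := Finset.univ.filter fun d =>
        ((d.1 : ℕ), (d.2 : ℕ)) ∈ E ∧ ¬ IsSide d.1 d.2
      isDiagonal := fun d hd => by
        have h := (Finset.mem_filter.1 hd).2
        exact ⟨Fin.lt_def.2 (hE.bounds _ _ h.1).2.1, h.2⟩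
      noncrossing := fun d hd e he h => by
        have hd := (Finset.mem_filter.1 hd).2.1
        have he := (Finset.mem_filter.1 he).2.1
        exact not_lt.2 (hE.noncrossing _ _ _ _ hd he h.1 h.2.1) h.2.2 }
  have hsub : ∀ i j, (i, j) ∈ E ∨ (i, j) ∈ D.edges → ∃ a b : Fin (n + 2), (a : ℕ) = i ∧
      (b : ℕ) = j := by
    intro i j h
    have : i < j ∧ j ≤ n + 1 := h.elim (fun h => (hE.bounds i j h).2)
      fun h => (D.edgeSystem.bounds i j h).2
    exact ⟨⟨i, by omega⟩, ⟨j, by omega⟩, rfl, rfl⟩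
  refine ⟨D, ?_⟩
  ext ⟨i, j⟩
  constructor
  · intro h
    obtain ⟨a, b, rfl, rfl⟩ := hsub i j (Or.inr h)
    rcases D.mem_edges_iff.1 h with (h | ⟨h1, h2⟩) | h
    · rw [← h]
      have := b.2
      exact hE.side _ (by omega) (by omega)
    · have e : (b : ℕ) = n + 1 := by omega
      rw [h1, e]
      exact hE.root
    · exact (Finset.mem_filter.1 h).2.1
  · intro h
    obtain ⟨a, b, rfl, rfl⟩ := hsub i j (Or.inl h)
    rw [D.mem_edges_iff]
    by_cases hs : IsSide a b
    · exact Or.inl hs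
    · exact Or.inr (Finset.mem_filter.2 ⟨Finset.mem_univ _, h, hs⟩)

theorem exists_dissection_of_mem_treesWith {k : ℕ} (t : BTTree.treesWith n k) :
    ∃ D : {D : TriQuadDissection (n + 2) // D.1.quadrilaterals = k},
      D.1.1.edges = t.1.edges 0 := by
  obtain ⟨t, ht, rfl⟩ := t
  have hE := t.edgeSystem_edges 0
  rw [ht, zero_add] at hE
  obtain ⟨D, hD⟩ := hE.exists_dissection
  refine ⟨⟨⟨D, D.forall_isRegion_iff.2 fun S hS => ?_⟩,
    Dissection.quadrilaterals_eq_quads hD.symm⟩, hD⟩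
  rw [hD, ← BTTree.mem_cells] at hS
  exact BTTree.card_of_mem_cells hS

theorem card_dissections (n k : ℕ) :
    Nat.card {D : TriQuadDissection (n + 2) // D.1.quadrilaterals = k} =
      (BTTree.treesWith n k).ncard := by
  rw [← Nat.card_coe_set_eq]
  choose f hf using exists_dissection_of_mem_treesWith (n := n) (k := k)
  refine (Nat.card_congr (Equiv.ofBijective f ⟨?_, ?_⟩)).symm
  · intro t t' h
    refine Subtype.ext (BTTree.edges_injective (a := 0) ?_)
    rw [← hf, ← hf, h]
  · rintro ⟨⟨D, hD⟩, hk⟩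
    obtain ⟨t, ht, hte⟩ := BTTree.exists_edges_eq D.edgeSystem (D.forall_isRegion_iff.1 hD)
    refine ⟨⟨t, by omega, (Dissection.quadrilaterals_eq_quads hte).symm.trans hk⟩, ?_⟩
    refine Subtype.ext (Subtype.ext (Dissection.edges_injective ?_))
    rw [hf, hte]

theorem finite_dissections (N : ℕ) : Finite (TriQuadDissection N) :=
  Finite.of_injective (fun D : TriQuadDissection N => D.1.diagonals) fun D D' h => by
    obtain ⟨⟨d, h1, h2⟩, h3⟩ := D
    obtain ⟨⟨d', h1', h2'⟩, h3'⟩ := D'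
    obtain rfl : d = d' := h
    rfl

end Dissections

/-! ### Summation over the fibres and the bijection -/

theorem card_eq_sum_card_fiber {α : Type*} [Finite α] (f : α → ℕ) {m : ℕ}
    (hf : ∀ k, m ≤ k → Nat.card {a // f a = k} = 0) :
    Nat.card α = ∑ k ∈ Finset.range m, Nat.card {a // f a = k} := by
  classical
  have := Fintype.ofFinite α
  have hmaps : ∀ a ∈ (Finset.univ : Finset α), f a ∈ Finset.range m := by
    intro a _
    by_contra h
    have h0 := hf (f a) (by simpa using h)
    rw [Finite.card_eq_zero_iff] at h0
    exact h0.elim ⟨a, rfl⟩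
  rw [Nat.card_eq_fintype_card, ← Finset.card_univ, Finset.card_eq_sum_card_fiberwise hmaps]
  refine Finset.sum_congr rfl fun k _ => ?_
  rw [Nat.card_eq_fintype_card, Fintype.card_subtype]

theorem ncard_treesWith_eq {n k : ℕ} (h : 2 * k ≤ n) :
    ((BTTree.treesWith n k).ncard : ℚ) =
      1 / ((n : ℚ) + 1) * (Nat.choose (2 * n - k) (n + k) : ℚ) * (Nat.choose (n + k) k : ℚ) := by
  obtain ⟨j, rfl⟩ : ∃ j, n = j + k := ⟨n - k, by omega⟩
  have h1 := ncard_runs_closed j k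
  -- Trinomial revision turns `(2 * j + k).choose (j + k) * j.choose k`, the form given by the path
  -- count, into the stated product of binomials.
  have h2 := Nat.choose_mul (n := 2 * j + k) (k := j + k + k) (s := j + k) (by omega)
  rw [show 2 * j + k - (j + k) = j by omega, show j + k + k - (j + k) = k by omega,
    Nat.choose_symm_add, mul_comm _ (j.choose k), ← h1] at h2
  rw [ncard_treesWith_eq_ncard_runs, show 2 * (j + k) - k = 2 * j + k by omega]
  have h3 : ((2 * j + k).choose (j + k + k) : ℚ) * ((j + k + k).choose k : ℚ) =
      ((j : ℚ) + k + 1) * (runs false (j + k) k 0).ncard := by exact_mod_cast h2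
  have h4 : (j : ℚ) + k + 1 ≠ 0 := by positivity
  rw [mul_assoc, h3]
  push_cast
  field_simp

theorem card_eq_sum_of_card_fiber {α : Type*} [Finite α] (f : α → ℕ) {n : ℕ}
    (hf : ∀ k, Nat.card {a // f a = k} = (BTTree.treesWith n k).ncard) :
    (Nat.card α : ℚ) = ∑ k ∈ Finset.range (n / 2 + 1),
      1 / ((n : ℚ) + 1) * (Nat.choose (2 * n - k) (n + k) : ℚ) *
        (Nat.choose (n + k) k : ℚ) := by
  rw [card_eq_sum_card_fiber f (m := n / 2 + 1) fun k hk => by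
    rw [hf, BTTree.treesWith_eq_empty (by omega), Set.ncard_empty]]
  push_cast
  refine Finset.sum_congr rfl fun k hk => ?_
  rw [hf, ncard_treesWith_eq]
  have := Finset.mem_range.1 hk
  omega

theorem card_avoiding_descents_eq (n k : ℕ) :
    Nat.card {p : AvoidingParkingFunction n patterns // descents p.1.perm = k} =
      (BTTree.treesWith n k).ncard := by
  rw [card_avoiding_descents, ncard_treesWith_eq_ncard_runs]

end PatternParking

theorem theoremT :
    (∀ n : ℕ, (PatternParking.pf n PatternParking.patterns : ℚ) =
      ∑ k ∈ Finset.range (n / 2 + 1),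
        1 / ((n : ℚ) + 1) * (Nat.choose (2 * n - k) (n + k) : ℚ) * (Nat.choose (n + k) k : ℚ)) ∧
    (∀ n : ℕ, 1 ≤ n → (Nat.card (PatternParking.TriQuadDissection (n + 2)) : ℚ) =
      ∑ k ∈ Finset.range (n / 2 + 1),
        1 / ((n : ℚ) + 1) * (Nat.choose (2 * n - k) (n + k) : ℚ) * (Nat.choose (n + k) k : ℚ)) ∧
    (∀ n : ℕ, 1 ≤ n →
      ∃ e : PatternParking.AvoidingParkingFunction n PatternParking.patterns ≃
          PatternParking.TriQuadDissection (n + 2),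
        ∀ p : PatternParking.AvoidingParkingFunction n PatternParking.patterns,
          (e p).1.quadrilaterals = PatternParking.descents p.1.perm) := by
  have := PatternParking.finite_avoiding
  have := PatternParking.finite_dissections
  refine ⟨fun n => ?_, fun n _ => ?_, fun n _ => ?_⟩
  · exact PatternParking.card_eq_sum_of_card_fiber _ (PatternParking.card_avoiding_descents_eq n)
  · exact PatternParking.card_eq_sum_of_card_fiber _ (PatternParking.card_dissections n)
  -- Fibres over the same `k` are finite of equal size, so arbitrary fibrewise bijections assemble
  -- into one that carries descents to quadrilaterals.
  · have e : ∀ k,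
        {p : PatternParking.AvoidingParkingFunction n PatternParking.patterns //
          PatternParking.descents p.1.perm = k} ≃
        {D : PatternParking.TriQuadDissection (n + 2) // D.1.quadrilaterals = k} := fun k =>
      Classical.choice (Finite.card_eq.1 ((PatternParking.card_avoiding_descents_eq n k).trans
        (PatternParking.card_dissections n k).symm))
    exact ⟨Equiv.ofFiberEquiv e, fun p => Equiv.ofFiberEquiv_map e p⟩
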